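/- **Theorem.** For $A\in\mathbb R^{d\times m}$ let $|A|$ be its Euclidean (Frobenius) norm, and for $b\in\mathbb R^d$ let $l_{A,b}(x)=Ax+b$. A *regular domain* in $\mathbb R^m$ is a nonempty bounded connected open set whose boundary is Lebesgue-null. A map $u:\Omega\to\mathbb R^d$ on a regular domain is *piecewise affine* if $\Omega=\bigcup_i\Omega_i\cup\mathcal N$ with at most countably many pairwise disjoint regular domains $\Omega_i\subset\Omega$ and a null set $\mathcal N$, such that $u$ agrees with an affine map on each $\Omega_i$. For $K,K'\subset\mathbb R^{d\times m}$, $1\le p<\infty$ and $C>0$, say that $(K,K')$ has property $R_p(C)$ if for all $A\in K$, $b\in\mathbb R^d$, $\varepsilon,\alpha\in(0,1)$, $s\in(1,\infty)$ and every regular domain $\Omega\subset\mathbb R^m$ there is a piecewise affine map $u\in W^{1,1}(\Omega;\mathbb R^d)\cap C^{\alpha}(\overline\Omega;\mathbb R^d)$ with $u=l_{A,b}$ on $\partial\Omega$, $$\int_{\{x\in\Omega:\ \nabla u(x)\notin K'\}}(1+|\nabla u|)^s\,dx<\varepsilon|\Omega|,$$ $$|\{x\in\Omega:\ |\nabla u(x)|>t\}|\le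 C\,(1+|A|^p)\,|\Omega|\,t^{-p}\quad\text{for all }t>0.$$ *$K$ can be reduced to $K'$ in weak $L^p$* if $(K,K')$ has property $R_p(M^p)$ for some $M\ge 1$. Let $K,K',K''\subset\mathbb R^{d\times m}$, $1\le p<\infty$, $1<q<\infty$, $p\ne q$, and $r=\min\{p,q\}$. If $K$ can be reduced to $K'$ in weak $L^p$ and $K'$ can be reduced to $K''$ in weak $L^q$, then $K$ can be reduced to $K''$ in weak $L^r$. More precisely, whenever $M',M''\ge1$ are such that $(K,K')$ has property $R_p((M')^p)$ and $(K',K'')$ has property $R_q((M'')^q)$, then $(K,K'')$ has property $$R_r\Bigl(4\bigl(1+\tfrac{q}{|q-p|}\bigr)(M'M'')^r\Bigr).$$ -/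

import Mathlib

open MeasureTheory Set
open scoped NNReal ENNReal ContDiff Matrix

noncomputable section

namespace WeakReduction

/-- Euclidean space `ℝⁿ`. -/
abbrev E (n : ℕ) : Type := EuclideanSpace ℝ (Fin n)

/-- Real `d × m` matrices. -/
abbrev Mat (d m : ℕ) : Type := Matrix (Fin d) (Fin m) ℝ

/-- The Euclidean (Frobenius) norm `|A|` of a matrix. -/
def matNorm {d m : ℕ} (A : Mat d m) : ℝ := √(∑ i, ∑ j, A i j ^ 2)

/-- The affine map `l_{A,b}(x) = A x + b`. -/
def affineMap {d m : ℕ} (A : Mat d m) (b : E d) (x : E m) : E d :=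
  WithLp.toLp 2 (A *ᵥ x.ofLp) + b

/-- Regular domain: open, bounded, connected (in particular nonempty), with Lebesgue-null
boundary. -/
structure IsRegularDomain {m : ℕ} (Ω : Set (E m)) : Prop where
  isOpen : IsOpen Ω
  isBounded : Bornology.IsBounded Ω
  isConnected : IsConnected Ω
  volume_frontier : volume (frontier Ω) = 0

/-- `u` is piecewise affine on `Ω`: up to a null set, `Ω` is a countable union of pairwise disjoint
regular domains on each of which `u` agrees with an affine map. -/
def IsPiecewiseAffine {d m : ℕ} (Ω : Set (E m)) (u : E m → E d) : Prop :=
  ∃ P : Set (Set (E m)), P.Countable ∧ P.PairwiseDisjoint id ∧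
    (∀ U ∈ P, IsRegularDomain U ∧ U ⊆ Ω ∧ ∃ (A : Mat d m) (b : E d), EqOn u (affineMap A b) U) ∧
    volume (Ω \ ⋃₀ P) = 0

/-- `u ∈ W^{1,1}(Ω; ℝᵈ)` with weak gradient `G`, where `G x i j` represents `∂ⱼ uᵢ (x)`: both are
integrable on `Ω` and integration by parts holds against all test functions in `C_c^∞(Ω)`. -/
structure IsW11WithGradient {d m : ℕ} (Ω : Set (E m)) (u : E m → E d) (G : E m → Mat d m) :
    Prop where
  integrableOn : IntegrableOn u Ω
  integrableOn_grad : ∀ i j, IntegrableOn (fun x => G x i j) Ω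
  integral_eq : ∀ (i : Fin d) (j : Fin m) (φ : E m → ℝ), ContDiff ℝ ∞ φ → HasCompactSupport φ →
    tsupport φ ⊆ Ω →
    ∫ x in Ω, u x i * fderiv ℝ φ x (EuclideanSpace.single j 1) = - ∫ x in Ω, G x i j * φ x

/-- The approximation property with coefficient `C` in the weak `L^p` bound: for all `A ∈ K`, `b`,
`ε, α ∈ (0,1)`, `s ∈ (1,∞)` and every regular domain `Ω` there is a piecewise affine
`u ∈ W^{1,1}(Ω) ∩ C^α(closure Ω)`, with weak gradient `G`, such that `u = l_{A,b}` on `∂Ω`,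
`∫_{x ∈ Ω, ∇u(x) ∉ K'} (1 + |∇u|)^s dx < ε |Ω|` and
`|{x ∈ Ω : |∇u(x)| > t}| ≤ C (1 + |A|^p) |Ω| t^{-p}` for all `t > 0`. -/
def ReductionBound {d m : ℕ} (K K' : Set (Mat d m)) (p C : ℝ) : Prop :=
  ∀ A ∈ K, ∀ (b : E d) (ε : ℝ) (α : ℝ≥0) (s : ℝ), 0 < ε → ε < 1 → 0 < α → α < 1 → 1 < s →
    ∀ Ω : Set (E m), IsRegularDomain Ω →
      ∃ (u : E m → E d) (G : E m → Mat d m),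
        IsPiecewiseAffine Ω u ∧
        IsW11WithGradient Ω u G ∧
        (∃ H : ℝ≥0, HolderOnWith H α u (closure Ω)) ∧
        EqOn u (affineMap A b) (frontier Ω) ∧
        ∫⁻ x in {x ∈ Ω | G x ∉ K'}, ENNReal.ofReal ((1 + matNorm (G x)) ^ s)
          < ENNReal.ofReal ε * volume Ω ∧
        ∀ t : ℝ, 0 < t →
          volume {x ∈ Ω | t < matNorm (G x)}
            ≤ ENNReal.ofReal (C * (1 + matNorm A ^ p) * t ^ (-p)) * volume Ω

/-- `K` can be reduced to `K'` in weak `L^p`: for some `M ≥ 1` the approximation property holds with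
coefficient `M ^ p`. -/
def CanBeReduced {d m : ℕ} (K K' : Set (Mat d m)) (p : ℝ) : Prop :=
  ∃ M : ℝ, 1 ≤ M ∧ ReductionBound K K' p (M ^ p)

end WeakReduction

end

/-!
Start from a map `u` realising the reduction of `K` to `K'` and cover almost all of each of its
affine pieces by disjoint balls. On a ball where `∇u = A ∈ K'`, insert a rescaled copy of a map
realising the reduction of `K'` to `K''` with boundary values `A x`. Rescaling to radius `r`
multiplies the Hölder constant by `r ^ (1 - α)`, so on small balls all the inserted perturbations
have Hölder constant at most `1`, and so do countable sums with disjoint supports, up to a factor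
`2`. That the zero extension of a perturbation lies in `W^{1,1}` follows by testing with cutoff
functions whose gradients are bounded in `L¹`, because a Hölder function vanishing on the boundary
is small where those gradients live.

The tail of the new gradient is at most `∫ min 1 ((M'' / t) ^ q * (1 + |∇u| ^ q))` plus the
contribution of `∇u ∉ K'`, and the weak `L^p` bound on `∇u` controls this integral by a multiple of
`t ^ (-min p q)`. The constant `q / |q - p|` arises because `p ≠ q` makes `τ ^ (q - p - 1)`
integrable at `0` (if `p < q`) or at `∞` (if `q < p`).
-/

namespace WeakReduction

open Filter Topology

variable {d m : ℕ}

section TestFunctions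

theorem fderiv_eq_zero_of_notMem_tsupport {φ : E m → ℝ} {x : E m} (hx : x ∉ tsupport φ) :
    fderiv ℝ φ x = 0 :=
  Function.notMem_support.1 fun h => hx (support_fderiv_subset ℝ h)

theorem setIntegral_mul_testFunction {S : Set (E m)} {φ : E m → ℝ} (h : tsupport φ ⊆ S)
    (f : E m → ℝ) : ∫ x in S, f x * φ x = ∫ x, f x * φ x :=
  setIntegral_eq_integral_of_forall_compl_eq_zero fun x hx => by
    rw [image_eq_zero_of_notMem_tsupport fun h' => hx (h h'), mul_zero]

theorem setIntegral_mul_fderiv_testFunction {S : Set (E m)} {φ : E m → ℝ} (h : tsupport φ ⊆ S)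
    (f : E m → ℝ) (v : E m) : ∫ x in S, f x * fderiv ℝ φ x v = ∫ x, f x * fderiv ℝ φ x v :=
  setIntegral_eq_integral_of_forall_compl_eq_zero fun x hx => by
    rw [fderiv_eq_zero_of_notMem_tsupport fun h' => hx (h h'), zero_apply,
      mul_zero]

theorem integrable_mul_testFunction {μ : Measure (E m)} {f φ : E m → ℝ}
    (hf : Integrable f μ) (hφ : Continuous φ) (hφc : HasCompactSupport φ) :
    Integrable (fun x => f x * φ x) μ := by
  obtain ⟨C, hC⟩ := hφc.exists_bound_of_continuous hφ
  exact hf.mul_bdd (c := C) hφ.aestronglyMeasurable (Eventually.of_forall hC)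

theorem continuous_fderiv_testFunction {φ : E m → ℝ} (hφ : ContDiff ℝ ∞ φ) (v : E m) :
    Continuous fun x => fderiv ℝ φ x v :=
  (hφ.continuous_fderiv (by simp)).clm_apply continuous_const

theorem enorm_integral_mul_fderiv_le {χ f : E m → ℝ} {η : ℝ≥0} (v : E m)
    (h : ∀ x, η ≤ ‖f x‖₊ → fderiv ℝ χ x = 0) :
    ‖∫ x, f x * fderiv ℝ χ x v‖ₑ ≤ η * ((∫⁻ x, ‖fderiv ℝ χ x‖ₑ) * ‖v‖ₑ) := by
  have hpt : ∀ x, ‖f x * fderiv ℝ χ x v‖ₑ ≤ η * (‖fderiv ℝ χ x‖ₑ * ‖v‖ₑ) := by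
    intro x
    rw [enorm_mul]
    by_cases hx : η ≤ ‖f x‖₊
    · simp [h x hx]
    · gcongr
      · exact ENNReal.coe_le_coe.2 (not_le.1 hx).le
      · exact (fderiv ℝ χ x).le_opENorm v
  calc ‖∫ x, f x * fderiv ℝ χ x v‖ₑ
      ≤ ∫⁻ x, η * (‖fderiv ℝ χ x‖ₑ * ‖v‖ₑ) :=
        (enorm_integral_le_lintegral_enorm _).trans (lintegral_mono hpt)
    _ = η * ((∫⁻ x, ‖fderiv ℝ χ x‖ₑ) * ‖v‖ₑ) := by
        rw [lintegral_const_mul' _ _ ENNReal.coe_ne_top, lintegral_mul_const' _ _ enorm_ne_top]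

theorem integrableOn_mul_testFunction_of_continuous_indicator {U : Set (E m)}
    (hU : MeasurableSet U) {w φ : E m → ℝ} (hw : Continuous (U.indicator w)) (hφ : Continuous φ)
    (hφc : HasCompactSupport φ) : IntegrableOn (fun x => w x * φ x) U :=
  ((hw.mul hφ).integrable_of_hasCompactSupport hφc.mul_left).integrableOn.congr_fun
    (fun x hx => by simp only [Pi.mul_apply, indicator_of_mem hx]) hU

theorem setIntegral_mul_fderiv_mul {U : Set (E m)} (hU : MeasurableSet U) {w φ χ : E m → ℝ}
    (hw : Continuous (U.indicator w)) (hφ : ContDiff ℝ ∞ φ) (hφc : HasCompactSupport φ)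
    (hχ : ContDiff ℝ ∞ χ) (v : E m) :
    ∫ x in U, w x * fderiv ℝ (φ * χ) x v = (∫ x in U, w x * fderiv ℝ φ x v * χ x) +
      ∫ x in U, w x * φ x * fderiv ℝ χ x v := by
  have hdφ := continuous_fderiv_testFunction hφ v
  have hdχ := continuous_fderiv_testFunction hχ v
  have hdφc := hφc.fderiv_apply (𝕜 := ℝ) v
  have h₁ : IntegrableOn (fun x => w x * (fderiv ℝ φ x v * χ x)) U :=
    integrableOn_mul_testFunction_of_continuous_indicator hU hw (hdφ.mul hχ.continuous)
      hdφc.mul_right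
  have h₂ : IntegrableOn (fun x => w x * (φ x * fderiv ℝ χ x v)) U :=
    integrableOn_mul_testFunction_of_continuous_indicator hU hw (hφ.continuous.mul hdχ)
      hφc.mul_right
  simp only [mul_assoc]
  rw [← integral_add h₁ h₂]
  congr 1 with x
  rw [fderiv_mul (hφ.differentiable (by simp) x) (hχ.differentiable (by simp) x)]
  simp only [add_apply, smul_apply, smul_eq_mul]
  ring

end TestFunctions

section Cutoff

/-- Smooth cutoff functions exhausting `U` whose gradients are bounded in `L¹`. Such a sequence
exists exactly when integration by parts extends across the boundary of `U` to functions vanishing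
there continuously; it plays the role of a regularity assumption (finite perimeter) on `U`. -/
structure IsExhaustingCutoff (U : Set (E m)) (χ : ℕ → E m → ℝ) : Prop where
  contDiff : ∀ n, ContDiff ℝ ∞ (χ n)
  tsupport_subset : ∀ n, tsupport (χ n) ⊆ U
  abs_le_one : ∀ n x, |χ n x| ≤ 1
  eventuallyEq_one : ∀ K ⊆ U, IsCompact K → ∀ᶠ n in atTop, ∀ x ∈ K, χ n =ᶠ[𝓝 x] 1
  exists_lintegral_fderiv_le : ∃ C : ℝ≥0, ∀ n, ∫⁻ x, ‖fderiv ℝ (χ n) x‖ₑ ≤ C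

namespace IsExhaustingCutoff

variable {U : Set (E m)} {χ : ℕ → E m → ℝ}

theorem tendsto_one (hχ : IsExhaustingCutoff U χ) {x : E m} (hx : x ∈ U) :
    Tendsto (fun n => χ n x) atTop (𝓝 1) := by
  refine tendsto_const_nhds.congr' ?_
  filter_upwards [hχ.eventuallyEq_one {x} (singleton_subset_iff.2 hx) isCompact_singleton] with n hn
  exact (hn x rfl).eq_of_nhds.symm

theorem tendsto_integral_mul_fderiv (hχ : IsExhaustingCutoff U χ) {f : E m → ℝ}
    (hf : Continuous f) (hfc : HasCompactSupport f) (hf0 : ∀ x ∉ U, f x = 0) (v : E m) :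
    Tendsto (fun n => ∫ x, f x * fderiv ℝ (χ n) x v) atTop (𝓝 0) := by
  obtain ⟨C, hC⟩ := hχ.exists_lintegral_fderiv_le
  rw [tendsto_zero_iff_enorm_tendsto_zero, ENNReal.tendsto_nhds_zero]
  intro ε hε
  obtain ⟨η, hη, hηε⟩ :=
    ENNReal.exists_nnreal_pos_mul_lt (ENNReal.mul_ne_top (ENNReal.coe_ne_top (r := C))
      (enorm_ne_top (x := v))) hε.ne'
  have hsupp : ∀ x, η ≤ ‖f x‖₊ → f x ≠ 0 := fun x hx => nnnorm_pos.1 (hη.trans_le hx)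
  have hK : IsCompact {x | η ≤ ‖f x‖₊} :=
    hfc.of_isClosed_subset (isClosed_le continuous_const hf.nnnorm) fun x hx =>
      subset_tsupport f (hsupp x hx)
  have hKU : {x | η ≤ ‖f x‖₊} ⊆ U := fun x hx => not_not.1 fun hxU => hsupp x hx (hf0 x hxU)
  filter_upwards [hχ.eventuallyEq_one _ hKU hK] with n hn
  have hd : ∀ x, η ≤ ‖f x‖₊ → fderiv ℝ (χ n) x = 0 := fun x hx => by
    simp [(hn x hx).fderiv_eq (𝕜 := ℝ)]
  calc ‖∫ x, f x * fderiv ℝ (χ n) x v‖ₑ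
      ≤ η * ((∫⁻ x, ‖fderiv ℝ (χ n) x‖ₑ) * ‖v‖ₑ) := enorm_integral_mul_fderiv_le v hd
    _ ≤ η * (C * ‖v‖ₑ) := by gcongr; exact hC n
    _ ≤ ε := hηε.le

theorem tendsto_setIntegral_mul (hχ : IsExhaustingCutoff U χ) (hU : MeasurableSet U) {f : E m → ℝ}
    (hf : IntegrableOn f U) :
    Tendsto (fun n => ∫ x in U, f x * χ n x) atTop (𝓝 (∫ x in U, f x)) := by
  refine tendsto_integral_of_dominated_convergence (fun x => ‖f x‖)
    (fun n => hf.aestronglyMeasurable.mul (hχ.contDiff n).continuous.aestronglyMeasurable)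
    hf.norm (fun n => Eventually.of_forall fun x => ?_) ?_
  · rw [norm_mul]
    exact mul_le_of_le_one_right (norm_nonneg _) (hχ.abs_le_one n x)
  · filter_upwards [ae_restrict_mem hU] with x hx
    simpa using (hχ.tendsto_one hx).const_mul (f x)

theorem setIntegral_mul_fderiv_eq_neg (hχ : IsExhaustingCutoff U χ) (hU : MeasurableSet U)
    {w g : E m → ℝ} (hw : Continuous (U.indicator w)) (hg : IntegrableOn g U) {v : E m}
    (hwg : ∀ ψ : E m → ℝ, ContDiff ℝ ∞ ψ → HasCompactSupport ψ → tsupport ψ ⊆ U →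
      ∫ x in U, w x * fderiv ℝ ψ x v = - ∫ x in U, g x * ψ x)
    {φ : E m → ℝ} (hφ : ContDiff ℝ ∞ φ) (hφc : HasCompactSupport φ) :
    ∫ x in U, w x * fderiv ℝ φ x v = - ∫ x in U, g x * φ x := by
  have hfirst := hχ.tendsto_setIntegral_mul hU
    (integrableOn_mul_testFunction_of_continuous_indicator hU hw
      (continuous_fderiv_testFunction hφ v) (hφc.fderiv_apply (𝕜 := ℝ) v))
  have hsecond : Tendsto (fun n => ∫ x in U, w x * φ x * fderiv ℝ (χ n) x v) atTop (𝓝 0) := by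
    refine (hχ.tendsto_integral_mul_fderiv (hw.mul hφ.continuous) hφc.mul_left
      (fun x hx => by simp [hx]) v).congr fun n => ?_
    rw [← integral_indicator hU]
    congr 1 with x
    by_cases hx : x ∈ U <;> simp [hx]
  have hright := hχ.tendsto_setIntegral_mul hU (integrable_mul_testFunction hg hφ.continuous hφc)
  have htest : ∀ n, (∫ x in U, w x * fderiv ℝ φ x v * χ n x) +
      ∫ x in U, w x * φ x * fderiv ℝ (χ n) x v = - ∫ x in U, g x * φ x * χ n x := by
    intro n
    rw [← setIntegral_mul_fderiv_mul hU hw hφ hφc (hχ.contDiff n), hwg (φ * χ n)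
      (hφ.mul (hχ.contDiff n))
      hφc.mul_right (tsupport_mul_subset_right.trans (hχ.tsupport_subset n))]
    simp only [Pi.mul_apply, mul_assoc]
  have hlim := (hfirst.add hsecond).congr htest
  rw [add_zero] at hlim
  exact tendsto_nhds_unique hlim hright.neg

end IsExhaustingCutoff

section BallCutoff

open Metric

theorem deriv_smoothTransition_eq_zero {t : ℝ} (ht : t ∉ Icc (0 : ℝ) 1) :
    deriv Real.smoothTransition t = 0 := by
  rcases lt_or_gt_of_ne (fun h : t = 0 => ht (by simp [h])) with h | h
  · have : Real.smoothTransition =ᶠ[𝓝 t] fun _ => 0 := by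
      filter_upwards [Iio_mem_nhds h] with y hy using
        Real.smoothTransition.zero_of_nonpos (le_of_lt hy)
    simp [this.deriv_eq]
  · have : Real.smoothTransition =ᶠ[𝓝 t] fun _ => 1 := by
      filter_upwards [Ioi_mem_nhds (not_le.1 fun h1 => ht ⟨h.le, h1⟩)] with y hy using
        Real.smoothTransition.one_of_one_le (le_of_lt hy)
    simp [this.deriv_eq]

theorem exists_norm_deriv_smoothTransition_le :
    ∃ D : ℝ, ∀ t, ‖deriv Real.smoothTransition t‖ ≤ D :=
  (HasCompactSupport.intro isCompact_Icc fun _ ht =>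
    deriv_smoothTransition_eq_zero ht).exists_bound_of_continuous
    ((Real.smoothTransition.contDiff (n := 1)).continuous_deriv le_rfl)

theorem volume_closedBall_diff_ball_le {δ : ℝ} (hδ₀ : 0 ≤ δ) (hδ₁ : δ < 1) :
    volume (closedBall (0 : E m) 1 \ ball 0 (1 - δ)) ≤
      ENNReal.ofReal (m * δ) * volume (ball (0 : E m) 1) := by
  have hsub : ball (0 : E m) (1 - δ) ⊆ closedBall 0 1 :=
    ball_subset_closedBall.trans (closedBall_subset_closedBall (by linarith))
  have hbern : 1 - (1 - δ) ^ m ≤ m * δ := by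
    have := one_add_mul_le_pow (a := -δ) (by linarith) m
    rw [← sub_eq_add_neg] at this
    linarith
  rw [measure_sdiff hsub measurableSet_ball.nullMeasurableSet measure_ball_lt_top.ne,
    Measure.addHaar_closedBall _ _ zero_le_one,
    Measure.addHaar_ball_of_pos volume 0 (sub_pos.2 hδ₁), finrank_euclideanSpace_fin, one_pow,
    ← ENNReal.sub_mul fun _ _ => measure_ball_lt_top.ne,
    ← ENNReal.ofReal_sub _ (pow_nonneg (sub_nonneg.2 hδ₁.le) m)]
  gcongr

/-- A cutoff of the unit ball: it is `1` where `‖x‖² ≤ 1 - 2 / (n + 3)` and `0` where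
`‖x‖² ≥ 1 - 1 / (n + 3)`. -/
noncomputable def ballCutoff (n : ℕ) (x : E m) : ℝ :=
  Real.smoothTransition ((n + 3) * (1 - ‖x‖ ^ 2) - 1)

theorem contDiff_ballCutoff (n : ℕ) : ContDiff ℝ ∞ (ballCutoff n : E m → ℝ) :=
  Real.smoothTransition.contDiff.comp <| ((contDiff_const.sub (contDiff_norm_sq ℝ)).const_smul
    ((n : ℝ) + 3)).sub contDiff_const

theorem tsupport_ballCutoff_subset (n : ℕ) : tsupport (ballCutoff n) ⊆ ball (0 : E m) 1 := by
  have hclosed : IsClosed {x : E m | 1 ≤ ((n : ℝ) + 3) * (1 - ‖x‖ ^ 2)} :=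
    isClosed_le continuous_const (by fun_prop)
  refine (closure_minimal (fun x hx => ?_) hclosed).trans fun x hx => ?_
  · change 1 ≤ ((n : ℝ) + 3) * (1 - ‖x‖ ^ 2)
    by_contra! h
    exact hx (Real.smoothTransition.zero_of_nonpos (by linarith))
  · have : 0 < 1 - ‖x‖ ^ 2 := pos_of_mul_pos_right (one_pos.trans_le hx) (by positivity)
    rw [mem_ball_zero_iff]
    nlinarith [norm_nonneg x]

theorem ballCutoff_eventuallyEq_one {n : ℕ} {x : E m} (hx : 2 < (n + 3) * (1 - ‖x‖ ^ 2)) :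
    ballCutoff n =ᶠ[𝓝 x] 1 := by
  have hopen : IsOpen {x : E m | 2 < ((n : ℝ) + 3) * (1 - ‖x‖ ^ 2)} :=
    isOpen_lt continuous_const (by fun_prop)
  filter_upwards [hopen.mem_nhds hx] with y (hy : 2 < ((n : ℝ) + 3) * (1 - ‖y‖ ^ 2))
  exact Real.smoothTransition.one_of_one_le (by linarith only [hy])

theorem fderiv_ballCutoff (n : ℕ) (x : E m) :
    fderiv ℝ (ballCutoff n) x = deriv Real.smoothTransition ((n + 3) * (1 - ‖x‖ ^ 2) - 1) •
      ((n + 3 : ℝ) • -(2 • innerSL ℝ x : E m →L[ℝ] ℝ)) := by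
  have hψ := ((Real.smoothTransition.contDiff (n := 1)).differentiable (by simp)
    ((n + 3) * (1 - ‖x‖ ^ 2) - 1)).hasDerivAt
  have hinner : HasFDerivAt (fun x : E m => ((n : ℝ) + 3) * (1 - ‖x‖ ^ 2) - 1)
      ((n + 3 : ℝ) • -(2 • innerSL ℝ x : E m →L[ℝ] ℝ)) x :=
    (((hasStrictFDerivAt_norm_sq x).hasFDerivAt.const_sub 1).const_mul _).sub_const 1
  exact (hψ.comp_hasFDerivAt x hinner).fderiv

theorem norm_fderiv_ballCutoff_le {D : ℝ} (hD : ∀ t, ‖deriv Real.smoothTransition t‖ ≤ D)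
    (n : ℕ) (x : E m) :
    ‖fderiv ℝ (ballCutoff n) x‖ ≤ (closedBall (0 : E m) 1 \ ball 0 (1 - 2 / (n + 3))).indicator
      (fun _ => D * ((n + 3) * 2)) x := by
  have hn : (0 : ℝ) < n + 3 := by positivity
  rw [fderiv_ballCutoff]
  by_cases hx : x ∈ closedBall (0 : E m) 1 \ ball 0 (1 - 2 / (n + 3))
  · have hx₁ : ‖x‖ ≤ 1 := mem_closedBall_zero_iff.1 hx.1
    have hD₀ : 0 ≤ D := (norm_nonneg _).trans (hD 0)
    rw [indicator_of_mem hx, norm_smul, norm_smul, norm_neg, ← Nat.cast_smul_eq_nsmul ℝ, norm_smul,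
      innerSL_apply_norm, Real.norm_of_nonneg hn.le, Nat.cast_ofNat, Real.norm_two]
    gcongr
    · exact hD _
    · linarith
  · have harg : ((n : ℝ) + 3) * (1 - ‖x‖ ^ 2) - 1 ∉ Icc (0 : ℝ) 1 := by
      rintro ⟨h₀, h₁⟩
      refine hx ⟨mem_closedBall_zero_iff.2 ?_, fun h => ?_⟩
      · have : 0 < 1 - ‖x‖ ^ 2 := pos_of_mul_pos_right (by linarith) hn.le
        nlinarith [norm_nonneg x]
      · have h : 2 / ((n : ℝ) + 3) < 1 - ‖x‖ := lt_sub_comm.1 (mem_ball_zero_iff.1 h)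
        have hx₁ : ‖x‖ ≤ 1 := sub_nonneg.1 ((by positivity : 0 ≤ 2 / ((n : ℝ) + 3)).trans h.le)
        have : 2 / ((n : ℝ) + 3) < 1 - ‖x‖ ^ 2 := by nlinarith [norm_nonneg x]
        linarith [(div_lt_iff₀' hn).1 this]
    rw [deriv_smoothTransition_eq_zero harg, zero_smul, norm_zero, indicator_of_notMem hx]

theorem lintegral_fderiv_ballCutoff_le {D : ℝ} (hD : ∀ t, ‖deriv Real.smoothTransition t‖ ≤ D)
    (n : ℕ) :
    ∫⁻ x, ‖fderiv ℝ (ballCutoff n : E m → ℝ) x‖ₑ ≤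
      ENNReal.ofReal (D * 4 * m) * volume (ball (0 : E m) 1) := by
  have hD₀ : 0 ≤ D := (norm_nonneg _).trans (hD 0)
  have hn : (2 : ℝ) / (n + 3) < 1 :=
    (div_lt_one (by positivity)).2 (by linarith [n.cast_nonneg (α := ℝ)])
  set shell := closedBall (0 : E m) 1 \ ball 0 (1 - 2 / (n + 3))
  have hpt : ∀ x, ‖fderiv ℝ (ballCutoff n) x‖ₑ ≤
      shell.indicator (fun _ => ENNReal.ofReal (D * ((n + 3) * 2))) x := by
    intro x
    rw [← ofReal_norm]
    exact (ENNReal.ofReal_le_ofReal (norm_fderiv_ballCutoff_le hD n x)).trans_eq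
      (congrFun (indicator_comp_of_zero ENNReal.ofReal_zero) x).symm
  calc ∫⁻ x, ‖fderiv ℝ (ballCutoff n : E m → ℝ) x‖ₑ
      ≤ ENNReal.ofReal (D * ((n + 3) * 2)) * volume shell :=
        (lintegral_mono hpt).trans (lintegral_indicator_const_le _ _)
    _ ≤ ENNReal.ofReal (D * ((n + 3) * 2)) *
        (ENNReal.ofReal (m * (2 / (n + 3))) * volume (ball (0 : E m) 1)) := by
        gcongr
        exact volume_closedBall_diff_ball_le (by positivity) hn
    _ = ENNReal.ofReal (D * 4 * m) * volume (ball (0 : E m) 1) := by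
        rw [← mul_assoc, ← ENNReal.ofReal_mul (by positivity)]
        congr 2
        field_simp
        ring

theorem isExhaustingCutoff_ballCutoff : IsExhaustingCutoff (ball (0 : E m) 1) ballCutoff where
  contDiff := contDiff_ballCutoff
  tsupport_subset := tsupport_ballCutoff_subset
  abs_le_one n x := by
    rw [ballCutoff, abs_of_nonneg (Real.smoothTransition.nonneg _)]
    exact Real.smoothTransition.le_one _
  eventuallyEq_one K hK hKc := by
    obtain ⟨r, hr, hKr⟩ := exists_lt_subset_ball hKc.isClosed hK
    filter_upwards [(tendsto_natCast_atTop_atTop (R := ℝ)).eventually_gt_atTop (2 / (1 - r))]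
      with n hn x hx
    refine ballCutoff_eventuallyEq_one ?_
    have hxr := mem_ball_zero_iff.1 (hKr hx)
    calc (2 : ℝ) < n * (1 - r) := (div_lt_iff₀ (sub_pos.2 hr)).1 hn
      _ ≤ (n + 3) * (1 - ‖x‖ ^ 2) := by
        gcongr
        · linarith
        · nlinarith [norm_nonneg x]
  exists_lintegral_fderiv_le := by
    obtain ⟨D, hD⟩ := exists_norm_deriv_smoothTransition_le
    refine ⟨(ENNReal.ofReal (D * 4 * m) * volume (ball (0 : E m) 1)).toNNReal, fun n => ?_⟩
    rw [ENNReal.coe_toNNReal (ENNReal.mul_ne_top ENNReal.ofReal_ne_top measure_ball_lt_top.ne)]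
    exact lintegral_fderiv_ballCutoff_le hD n

end BallCutoff

end Cutoff

section MatNorm

theorem matNorm_nonneg (A : Mat d m) : 0 ≤ matNorm A := Real.sqrt_nonneg _

theorem abs_entry_le_matNorm (A : Mat d m) (i : Fin d) (j : Fin m) : |A i j| ≤ matNorm A := by
  refine Real.abs_le_sqrt ?_
  calc A i j ^ 2 ≤ ∑ j, A i j ^ 2 :=
        Finset.single_le_sum (f := fun j => A i j ^ 2) (fun _ _ => sq_nonneg _) (Finset.mem_univ j)
    _ ≤ ∑ i, ∑ j, A i j ^ 2 :=
        Finset.single_le_sum (f := fun i => ∑ j, A i j ^ 2)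
          (fun _ _ => Finset.sum_nonneg fun _ _ => sq_nonneg _) (Finset.mem_univ i)

theorem matNorm_le_sum_abs (A : Mat d m) : matNorm A ≤ ∑ i, ∑ j, |A i j| := by
  refine Real.sqrt_le_iff.2 ⟨by positivity, ?_⟩
  simpa [Fintype.sum_prod_type] using Finset.sum_sq_le_sq_sum_of_nonneg
    (s := (Finset.univ : Finset (Fin d × Fin m))) (f := fun p => |A p.1 p.2|)
    (fun _ _ => abs_nonneg _)

variable {μ : Measure (E m)} {G : E m → Mat d m}

theorem aemeasurable_matNorm (hG : ∀ i j, AEMeasurable (fun x => G x i j) μ) :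
    AEMeasurable (fun x => matNorm (G x)) μ := by
  unfold matNorm
  fun_prop

theorem integrable_matNorm (hG : ∀ i j, Integrable (fun x => G x i j) μ) :
    Integrable (fun x => matNorm (G x)) μ := by
  have hsum : Integrable (fun x => ∑ i, ∑ j, |G x i j|) μ :=
    integrable_finsetSum _ fun i _ => integrable_finsetSum _ fun j _ => (hG i j).abs
  refine hsum.mono' (aemeasurable_matNorm fun i j =>
    (hG i j).aemeasurable).aestronglyMeasurable (Eventually.of_forall fun x => ?_)
  rw [Real.norm_of_nonneg (matNorm_nonneg _)]
  exact matNorm_le_sum_abs _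

end MatNorm

section Affine

theorem affineMap_apply (A : Mat d m) (b : E d) (x : E m) (i : Fin d) :
    affineMap A b x i = ∑ j, A i j * x j + b i := rfl

theorem affineMap_add_affineMap (A A' : Mat d m) (b b' : E d) (x : E m) :
    affineMap A b x + affineMap A' b' x = affineMap (A + A') (b + b') x := by
  simp only [affineMap, Matrix.add_mulVec, WithLp.toLp_add]
  abel

theorem affineMap_sub_affineMap (A A' : Mat d m) (b b' : E d) (x : E m) :
    affineMap A b x - affineMap A' b' x = affineMap (A - A') (b - b') x := by
  simp only [affineMap, Matrix.sub_mulVec, WithLp.toLp_sub]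
  abel

theorem smul_affineMap_smul_sub (A : Mat d m) (b : E d) {r : ℝ} (hr : r ≠ 0) (c x : E m) :
    r • affineMap A b (r⁻¹ • (x - c)) = affineMap A (r • b - affineMap A 0 c) x := by
  simp only [affineMap, WithLp.ofLp_smul, WithLp.ofLp_sub, Matrix.mulVec_smul, Matrix.mulVec_sub,
    WithLp.toLp_smul, WithLp.toLp_sub, smul_add, smul_sub, smul_inv_smul₀ hr]
  abel

theorem lipschitzWith_affineMap (A : Mat d m) (b : E d) :
    LipschitzWith ‖(Matrix.toEuclideanLin A).toContinuousLinearMap‖₊ (affineMap A b) := by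
  refine LipschitzWith.of_dist_le_mul fun x y => ?_
  rw [show dist (affineMap A b x) (affineMap A b y) = _ from dist_add_right _ _ b]
  exact (Matrix.toEuclideanLin A).toContinuousLinearMap.lipschitz.dist_le_mul x y

theorem continuous_affineMap (A : Mat d m) (b : E d) : Continuous (affineMap A b) :=
  (lipschitzWith_affineMap A b).continuous

theorem hasFDerivAt_affineMap_apply (A : Mat d m) (b : E d) (i : Fin d) (x : E m) :
    HasFDerivAt (fun x => affineMap A b x i)
      (∑ j, A i j • (EuclideanSpace.proj j : E m →L[ℝ] ℝ)) x := by
  simp_rw [affineMap_apply]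
  exact (HasFDerivAt.fun_sum fun j _ =>
    ((EuclideanSpace.proj j : E m →L[ℝ] ℝ).hasFDerivAt (x := x)).const_mul (A i j)).add_const _

theorem fderiv_affineMap_apply (A : Mat d m) (b : E d) (i : Fin d) (j : Fin m) (x : E m) :
    fderiv ℝ (fun x => affineMap A b x i) x (EuclideanSpace.single j 1) = A i j := by
  rw [(hasFDerivAt_affineMap_apply A b i x).fderiv]
  simp

end Affine

namespace IsW11WithGradient

variable {Ω : Set (E m)} {u u' : E m → E d} {G G' : E m → Mat d m}

theorem integrableOn_apply (h : IsW11WithGradient Ω u G) (i : Fin d) :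
    IntegrableOn (fun x => u x i) Ω :=
  Integrable.eval_piLp h.integrableOn i

theorem mono (h : IsW11WithGradient Ω u G) {U : Set (E m)} (hU : U ⊆ Ω) :
    IsW11WithGradient U u G where
  integrableOn := h.integrableOn.mono_set hU
  integrableOn_grad i j := (h.integrableOn_grad i j).mono_set hU
  integral_eq i j φ hφ hφc hφU := by
    have hΩ := h.integral_eq i j φ hφ hφc (hφU.trans hU)
    rwa [setIntegral_mul_testFunction (hφU.trans hU),
      setIntegral_mul_fderiv_testFunction (hφU.trans hU) (fun x => u x i),
      ← setIntegral_mul_testFunction hφU,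
      ← setIntegral_mul_fderiv_testFunction hφU (fun x => u x i)] at hΩ

theorem congr (h : IsW11WithGradient Ω u G) (hΩ : MeasurableSet Ω) (hu : EqOn u u' Ω) :
    IsW11WithGradient Ω u' G where
  integrableOn := h.integrableOn.congr_fun hu hΩ
  integrableOn_grad := h.integrableOn_grad
  integral_eq i j φ hφ hφc hφU := by
    rw [← h.integral_eq i j φ hφ hφc hφU]
    exact setIntegral_congr_fun hΩ fun x hx => by simp only [hu hx]

theorem add (h : IsW11WithGradient Ω u G) (h' : IsW11WithGradient Ω u' G') :
    IsW11WithGradient Ω (fun x => u x + u' x) (fun x => G x + G' x) where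
  integrableOn := h.integrableOn.add h'.integrableOn
  integrableOn_grad i j := (h.integrableOn_grad i j).add (h'.integrableOn_grad i j)
  integral_eq i j φ hφ hφc hφU := by
    have hd := continuous_fderiv_testFunction hφ (EuclideanSpace.single j 1)
    have hdc := hφc.fderiv_apply (𝕜 := ℝ) (EuclideanSpace.single j 1)
    simp only [PiLp.add_apply, Matrix.add_apply, add_mul]
    rw [integral_add (integrable_mul_testFunction (h.integrableOn_apply i) hd hdc)
        (integrable_mul_testFunction (h'.integrableOn_apply i) hd hdc),
      integral_add (integrable_mul_testFunction (h.integrableOn_grad i j) hφ.continuous hφc)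
        (integrable_mul_testFunction (h'.integrableOn_grad i j) hφ.continuous hφc),
      h.integral_eq i j φ hφ hφc hφU, h'.integral_eq i j φ hφ hφc hφU, neg_add]

theorem neg (h : IsW11WithGradient Ω u G) :
    IsW11WithGradient Ω (fun x => - u x) (fun x => - G x) where
  integrableOn := h.integrableOn.neg
  integrableOn_grad i j := (h.integrableOn_grad i j).neg
  integral_eq i j φ hφ hφc hφU := by
    simp only [PiLp.neg_apply, Matrix.neg_apply, neg_mul, integral_neg,
      h.integral_eq i j φ hφ hφc hφU]

theorem sub (h : IsW11WithGradient Ω u G) (h' : IsW11WithGradient Ω u' G') :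
    IsW11WithGradient Ω (fun x => u x - u' x) (fun x => G x - G' x) := by
  simpa only [sub_eq_add_neg] using h.add h'.neg

theorem ae_eq (h : IsW11WithGradient Ω u G) (h' : IsW11WithGradient Ω u G') (hΩ : IsOpen Ω) :
    ∀ᵐ x, x ∈ Ω → G x = G' x := by
  have hentry : ∀ i j, ∀ᵐ x, x ∈ Ω → G x i j - G' x i j = 0 := by
    intro i j
    refine hΩ.ae_eq_zero_of_integral_contDiff_smul_eq_zero
      ((h.integrableOn_grad i j).sub (h'.integrableOn_grad i j)).locallyIntegrableOn
      fun φ hφ hφc hφU => ?_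
    have hGG' : ∫ x in Ω, G' x i j * φ x = ∫ x in Ω, G x i j * φ x := by
      rw [← neg_inj, ← h.integral_eq i j φ hφ hφc hφU, h'.integral_eq i j φ hφ hφc hφU]
    simp only [smul_eq_mul, mul_comm (φ _)]
    rw [← setIntegral_mul_testFunction hφU]
    simp only [sub_mul]
    rw [integral_sub (integrable_mul_testFunction (h.integrableOn_grad i j) hφ.continuous hφc)
      (integrable_mul_testFunction (h'.integrableOn_grad i j) hφ.continuous hφc), hGG', sub_self]
  filter_upwards [ae_all_iff.2 fun i => ae_all_iff.2 fun j => hentry i j] with x hx hxΩ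
  ext i j
  exact sub_eq_zero.1 (hx i j hxΩ)

theorem affineMap (hΩ : Bornology.IsBounded Ω) (A : Mat d m) (b : E d) :
    IsW11WithGradient Ω (affineMap A b) (fun _ => A) where
  integrableOn := ((continuous_affineMap A b).locallyIntegrable.integrableOn_isCompact
    hΩ.isCompact_closure).mono_set subset_closure
  integrableOn_grad i j := integrableOn_const hΩ.measure_lt_top.ne
  integral_eq i j φ hφ hφc hφU := by
    rw [setIntegral_mul_testFunction hφU (fun _ => A i j),
      setIntegral_mul_fderiv_testFunction hφU (fun x => WeakReduction.affineMap A b x i)]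
    have hd := continuous_fderiv_testFunction hφ (EuclideanSpace.single j 1)
    have hdc := hφc.fderiv_apply (𝕜 := ℝ) (EuclideanSpace.single j 1)
    have hl : Continuous fun x => WeakReduction.affineMap A b x i := by
      have := continuous_affineMap A b
      fun_prop
    rw [integral_mul_fderiv_eq_neg_fderiv_mul_of_integrable]
    · simp_rw [fderiv_affineMap_apply]
    · simp_rw [fderiv_affineMap_apply]
      exact (continuous_const.mul hφ.continuous).integrable_of_hasCompactSupport hφc.mul_left
    · exact (hl.mul hd).integrable_of_hasCompactSupport hdc.mul_left
    · exact (hl.mul hφ.continuous).integrable_of_hasCompactSupport hφc.mul_left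
    · exact fun x _ => (hasFDerivAt_affineMap_apply A b i x).differentiableAt
    · exact fun x _ => hφ.differentiable (by simp) x

theorem ae_eq_of_eqOn_affineMap (h : IsW11WithGradient Ω u G) {U : Set (E m)} (hU : IsOpen U)
    (hUb : Bornology.IsBounded U) (hUΩ : U ⊆ Ω) {A : Mat d m} {b : E d}
    (hu : EqOn u (WeakReduction.affineMap A b) U) : ∀ᵐ x, x ∈ U → G x = A :=
  ((h.mono hUΩ).congr hU.measurableSet hu).ae_eq (.affineMap hUb A b) hU

theorem indicator (h : IsW11WithGradient Ω u G) {χ : ℕ → E m → ℝ} (hχ : IsExhaustingCutoff Ω χ)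
    (hΩ : MeasurableSet Ω) (hu : Continuous (Ω.indicator u)) :
    IsW11WithGradient univ (Ω.indicator u) (Ω.indicator G) := by
  have hui : ∀ i, (fun x => Ω.indicator u x i) = Ω.indicator fun x => u x i := fun i =>
    (indicator_comp_of_zero (g := fun y : E d => y i) rfl).symm
  have hGij : ∀ i j, (fun x => Ω.indicator G x i j) = Ω.indicator fun x => G x i j := fun i j =>
    (indicator_comp_of_zero (g := fun B : Mat d m => B i j) rfl).symm
  refine ⟨?_, fun i j => ?_, fun i j φ hφ hφc _ => ?_⟩
  · exact (h.integrableOn.integrable_indicator hΩ).integrableOn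
  · rw [hGij]
    exact ((h.integrableOn_grad i j).integrable_indicator hΩ).integrableOn
  · have hcont : Continuous (Ω.indicator fun x => u x i) := by
      rw [← hui]
      fun_prop
    have hind : ∀ f ψ : E m → ℝ, ∫ x, Ω.indicator f x * ψ x = ∫ x in Ω, f x * ψ x := fun f ψ => by
      rw [← integral_indicator hΩ]
      simp only [indicator_mul_left]
    simp only [Measure.restrict_univ, congrFun (hui i), congrFun (hGij i j), hind]
    exact hχ.setIntegral_mul_fderiv_eq_neg hΩ hcont (h.integrableOn_grad i j)
      (h.integral_eq i j) hφ hφc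

end IsW11WithGradient

section Rescale

/-- The similarity `x ↦ r⁻¹ (x - c)`, which maps `ball c r` onto the unit ball. -/
noncomputable def unscale (c : E m) {r : ℝ} (hr : 0 < r) : E m ≃ₜ E m :=
  (Homeomorph.subRight c).trans (Homeomorph.smulOfNeZero r⁻¹ (inv_ne_zero hr.ne'))

variable (c : E m) {r : ℝ} (hr : 0 < r)

theorem unscale_apply (x : E m) : unscale c hr x = r⁻¹ • (x - c) := rfl

theorem smul_unscale_add (x : E m) : r • unscale c hr x + c = x := by
  rw [unscale_apply, smul_inv_smul₀ hr.ne', sub_add_cancel]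

theorem dist_unscale (x y : E m) : dist (unscale c hr x) (unscale c hr y) = r⁻¹ * dist x y := by
  rw [unscale_apply, unscale_apply, dist_smul₀, dist_sub_right, norm_inv,
    Real.norm_of_nonneg hr.le]

theorem preimage_unscale_ball : unscale c hr ⁻¹' Metric.ball 0 1 = Metric.ball c r := by
  ext x
  rw [mem_preimage, Metric.mem_ball, Metric.mem_ball,
    show (0 : E m) = unscale c hr c by simp [unscale_apply], dist_unscale, inv_mul_lt_one₀ hr]

theorem measurePreserving_unscale :
    MeasurePreserving (unscale c hr) volume (ENNReal.ofReal (r ^ m) • volume) := by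
  refine ⟨(unscale c hr).continuous.measurable, ?_⟩
  rw [show ⇑(unscale c hr) = (fun x => r⁻¹ • x) ∘ fun x => x - c from rfl,
    ← Measure.map_map (measurable_const_smul _) (measurable_sub_const c),
    (measurePreserving_sub_right volume c).map_eq,
    Measure.map_addHaar_smul _ (inv_ne_zero hr.ne'), finrank_euclideanSpace_fin, inv_pow, inv_inv,
    abs_of_pos (pow_pos hr m)]

theorem volume_preimage_unscale (s : Set (E m)) :
    volume (unscale c hr ⁻¹' s) = ENNReal.ofReal (r ^ m) * volume s :=
  (measurePreserving_unscale c hr).measure_preimage_emb (unscale c hr).measurableEmbedding s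

theorem setLIntegral_preimage_unscale (s : Set (E m)) (F : E m → ℝ≥0∞) :
    ∫⁻ x in unscale c hr ⁻¹' s, F (unscale c hr x) = ENNReal.ofReal (r ^ m) * ∫⁻ x in s, F x := by
  rw [(measurePreserving_unscale c hr).setLIntegral_comp_preimage_emb
    (unscale c hr).measurableEmbedding, Measure.restrict_smul, lintegral_smul_measure, smul_eq_mul]

theorem integral_comp_unscale (F : E m → ℝ) : ∫ x, F (unscale c hr x) = r ^ m * ∫ x, F x := by
  rw [(measurePreserving_unscale c hr).integral_comp (unscale c hr).measurableEmbedding,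
    integral_smul_measure, ENNReal.toReal_ofReal (pow_nonneg hr.le m), smul_eq_mul]

variable {c hr}

theorem integrable_comp_unscale {F : Type*} [NormedAddCommGroup F] {f : E m → F}
    (hf : Integrable f) : Integrable fun x => f (unscale c hr x) :=
  ((measurePreserving_unscale c hr).integrable_comp_emb (unscale c hr).measurableEmbedding).2
    (hf.smul_measure ENNReal.ofReal_ne_top)

theorem IsW11WithGradient.rescale {u : E m → E d} {G : E m → Mat d m}
    (h : IsW11WithGradient univ u G) :
    IsW11WithGradient univ (fun x => r • u (unscale c hr x)) (fun x => G (unscale c hr x)) where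
  integrableOn :=
    ((integrable_comp_unscale (integrableOn_univ.1 h.integrableOn)).smul r).integrableOn
  integrableOn_grad i j :=
    (integrable_comp_unscale (integrableOn_univ.1 (h.integrableOn_grad i j))).integrableOn
  integral_eq i j φ hφ hφc _ := by
    set v : E m := EuclideanSpace.single j 1
    set ψ : E m → ℝ := fun y => φ (r • y + c) with hψ
    have hψs : ContDiff ℝ ∞ ψ := hφ.comp (by fun_prop)
    have hψc : HasCompactSupport ψ := hφc.comp_homeomorph
      ((Homeomorph.smulOfNeZero r hr.ne').trans (Homeomorph.addRight c))
    have hψd : ∀ y, fderiv ℝ ψ y v = r * fderiv ℝ φ (r • y + c) v := by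
      intro y
      have haff : HasFDerivAt (fun y : E m => r • y + c) (r • ContinuousLinearMap.id ℝ (E m)) y :=
        ((hasFDerivAt_id y).const_smul r).add_const c
      have := (hφ.differentiable (by simp) (r • y + c)).hasFDerivAt.comp y haff
      rw [show ψ = φ ∘ fun y => r • y + c from rfl, this.fderiv]
      simp
    have hleft := integral_comp_unscale c hr fun y => u y i * fderiv ℝ ψ y v
    have hright := integral_comp_unscale c hr fun y => G y i j * ψ y
    have hunit := h.integral_eq i j ψ hψs hψc (subset_univ _)
    simp only [Measure.restrict_univ] at hunit ⊢
    rw [hunit, mul_neg, ← hright] at hleft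
    simp only [hψd] at hleft
    simp only [hψ, smul_unscale_add] at hleft
    simpa only [PiLp.smul_apply, smul_eq_mul, mul_assoc, mul_left_comm] using hleft

theorem IsRegularDomain.preimage_unscale {U : Set (E m)} (hU : IsRegularDomain U) :
    IsRegularDomain (unscale c hr ⁻¹' U) where
  isOpen := hU.isOpen.preimage (unscale c hr).continuous
  isBounded := by
    obtain ⟨D, hD⟩ := Metric.isBounded_iff.1 hU.isBounded
    refine Metric.isBounded_iff.2 ⟨r * D, fun x hx y hy => ?_⟩
    simpa only [dist_unscale, inv_mul_le_iff₀ hr] using hD hx hy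
  isConnected := (unscale c hr).isConnected_preimage.2 hU.isConnected
  volume_frontier := by
    rw [← Homeomorph.preimage_frontier, volume_preimage_unscale, hU.volume_frontier, mul_zero]

theorem IsPiecewiseAffine.rescale {Ω : Set (E m)} {u : E m → E d} (hu : IsPiecewiseAffine Ω u) :
    IsPiecewiseAffine (unscale c hr ⁻¹' Ω) fun x => r • u (unscale c hr x) := by
  obtain ⟨P, hPc, hPd, hP, hPv⟩ := hu
  refine ⟨preimage (unscale c hr) '' P, hPc.image _, ?_, ?_, ?_⟩
  · rintro _ ⟨U, hU, rfl⟩ _ ⟨U', hU', rfl⟩ hne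
    exact (hPd hU hU' fun h => hne (by rw [h])).preimage _
  · rintro _ ⟨U, hU, rfl⟩
    obtain ⟨hUreg, hUΩ, A, b, huA⟩ := hP U hU
    refine ⟨hUreg.preimage_unscale, preimage_mono hUΩ, A, r • b - affineMap A 0 c, fun x hx => ?_⟩
    rw [← smul_affineMap_smul_sub A b hr.ne', ← unscale_apply c hr]
    exact congrArg (r • ·) (huA hx)
  · rw [sUnion_image, ← preimage_sUnion, ← preimage_sdiff, volume_preimage_unscale, hPv, mul_zero]

end Rescale

section Holder

variable {X Y : Type*} [PseudoMetricSpace X] [SeminormedAddCommGroup Y] {H H' α : ℝ≥0} {f g : X → Y}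
  {S : Set X}

theorem holderOnWith_of_dist_le
    (h : ∀ x ∈ S, ∀ y ∈ S, dist (f x) (f y) ≤ H * dist x y ^ (α : ℝ)) : HolderOnWith H α f S := by
  intro x hx y hy
  rw [edist_nndist, edist_nndist, ← ENNReal.coe_rpow_of_nonneg _ α.coe_nonneg]
  exact_mod_cast h x hx y hy

theorem holderWith_of_dist_le (h : ∀ x y, dist (f x) (f y) ≤ H * dist x y ^ (α : ℝ)) :
    HolderWith H α f :=
  holderOnWith_univ.1 (holderOnWith_of_dist_le fun x _ y _ => h x y)

theorem holderOnWith_add (hf : HolderOnWith H α f S) (hg : HolderOnWith H' α g S) :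
    HolderOnWith (H + H') α (fun x => f x + g x) S :=
  HolderWith.restrict_iff.1 ((HolderWith.restrict_iff.2 hf).add (HolderWith.restrict_iff.2 hg))

theorem holderOnWith_sub (hf : HolderOnWith H α f S) (hg : HolderOnWith H' α g S) :
    HolderOnWith (H + H') α (fun x => f x - g x) S := by
  have hneg : HolderOnWith H' α (fun x => - g x) S := fun x hx y hy => by
    rw [edist_neg_neg]
    exact hg x hx y hy
  simpa only [sub_eq_add_neg] using holderOnWith_add hf hneg

theorem exists_holderOnWith_of_lipschitzWith (hf : LipschitzWith H f) (hS : Bornology.IsBounded S)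
    (hα : α ≤ 1) : ∃ H' : ℝ≥0, HolderOnWith H' α f S := by
  obtain ⟨D, hD⟩ := Metric.isBounded_iff.1 hS
  refine ⟨_, HolderOnWith.of_le (D := D.toNNReal) (fun x hx y hy => ?_)
    (holderOnWith_one.2 hf.lipschitzOnWith) hα⟩
  rw [edist_dist]
  exact ENNReal.ofReal_le_ofReal (hD hx hy)

theorem holderWith_tsum_of_disjoint_support {ι : Type*} {W : ι → X → Y}
    (hW : ∀ k, HolderWith H α (W k))
    (hd : Pairwise fun k l => Disjoint (Function.support (W k)) (Function.support (W l))) :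
    HolderWith (2 * H) α fun x => ∑' k, W k x := by
  refine holderWith_of_dist_le fun x y => ?_
  rcases isEmpty_or_nonempty ι with _ | _
  · simpa only [tsum_empty, dist_self] using by positivity
  have hsingle : ∀ z, ∃ k, ∀ j, j ≠ k → W j z = 0 := by
    intro z
    by_cases hz : ∃ k, W k z ≠ 0
    · obtain ⟨k, hk⟩ := hz
      exact ⟨k, fun j hj => not_not.1 fun hj0 => disjoint_left.1 (hd hj) hj0 hk⟩
    · push Not at hz
      exact ⟨Classical.arbitrary ι, fun j _ => hz j⟩
  obtain ⟨k, hk⟩ := hsingle x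
  obtain ⟨l, hl⟩ := hsingle y
  rw [tsum_eq_single k hk, tsum_eq_single l hl, NNReal.coe_mul, NNReal.coe_two, mul_assoc, two_mul]
  by_cases hkl : k = l
  · subst hkl
    exact ((hW k).dist_le x y).trans (le_add_of_nonneg_right (by positivity))
  calc dist (W k x) (W l y) ≤ dist (W k x) 0 + dist 0 (W l y) := dist_triangle _ _ _
    _ = dist (W k x) (W k y) + dist (W l x) (W l y) := by rw [hl k hkl, hk l (Ne.symm hkl)]
    _ ≤ H * dist x y ^ (α : ℝ) + H * dist x y ^ (α : ℝ) :=
      add_le_add ((hW k).dist_le x y) ((hW l).dist_le x y)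

variable {V : Type*} [NormedAddCommGroup V] [NormedSpace ℝ V] {U : Set V}

theorem exists_mem_segment_frontier (hU : IsOpen U) {x y : V} (hx : x ∈ U) (hy : y ∉ U) :
    ∃ z ∈ segment ℝ x y, z ∈ frontier U := by
  by_contra! h
  rw [hU.frontier_eq] at h
  have hcover : segment ℝ x y ⊆ U ∪ (closure U)ᶜ := fun z hz =>
    or_iff_not_imp_left.2 fun hzU hzc => h z hz ⟨hzc, hzU⟩
  obtain ⟨z, -, hzU, hzc⟩ := (convex_segment x y).isPreconnected U (closure U)ᶜ hU
    isClosed_closure.isOpen_compl hcover ⟨x, left_mem_segment ℝ x y, hx⟩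
    ⟨y, right_mem_segment ℝ x y, fun hyc => h y (right_mem_segment ℝ x y) ⟨hyc, hy⟩⟩
  exact hzc (subset_closure hzU)

theorem holderWith_indicator (hU : IsOpen U) {f : V → Y} (hf : HolderOnWith H α f (closure U))
    (hf0 : ∀ x ∈ frontier U, f x = 0) : HolderWith H α (U.indicator f) := by
  have hcross : ∀ x ∈ U, ∀ y ∉ U,
      dist (U.indicator f x) (U.indicator f y) ≤ H * dist x y ^ (α : ℝ) := by
    intro x hx y hy
    obtain ⟨z, hz, hzU⟩ := exists_mem_segment_frontier hU hx hy
    rw [indicator_of_mem hx, indicator_of_notMem hy, ← hf0 z hzU]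
    refine (hf.dist_le (subset_closure hx) (frontier_subset_closure hzU)).trans ?_
    gcongr
    exact (le_add_of_nonneg_right dist_nonneg).trans_eq (dist_add_dist_of_mem_segment hz)
  refine holderWith_of_dist_le fun x y => ?_
  by_cases hx : x ∈ U <;> by_cases hy : y ∈ U
  · rw [indicator_of_mem hx, indicator_of_mem hy]
    exact hf.dist_le (subset_closure hx) (subset_closure hy)
  · exact hcross x hx y hy
  · rw [dist_comm, dist_comm x]
    exact hcross y hy x hx
  · rw [indicator_of_notMem hx, indicator_of_notMem hy, dist_self]
    positivity

end Holder

section WeakLp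

theorem setLIntegral_Ioc_rpow_sub_one {e a : ℝ} (he : 0 < e) (ha : 0 ≤ a) :
    ∫⁻ t in Ioc 0 a, ENNReal.ofReal (t ^ (e - 1)) = ENNReal.ofReal (a ^ e / e) := by
  have hi : IntegrableOn (fun t : ℝ => t ^ (e - 1)) (Ioc 0 a) :=
    (intervalIntegrable_iff_integrableOn_Ioc_of_le ha).1
      (intervalIntegral.intervalIntegrable_rpow' (by linarith))
  rw [← ofReal_integral_eq_lintegral_ofReal hi, ← intervalIntegral.integral_of_le ha,
    integral_rpow (Or.inl (by linarith)), sub_add_cancel, Real.zero_rpow he.ne', sub_zero]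
  filter_upwards [ae_restrict_mem measurableSet_Ioc] with t ht
  exact Real.rpow_nonneg ht.1.le _

theorem setLIntegral_Ioi_rpow_sub_one {e a : ℝ} (he : e < 0) (ha : 0 < a) :
    ∫⁻ t in Ioi a, ENNReal.ofReal (t ^ (e - 1)) = ENNReal.ofReal (a ^ e / -e) := by
  rw [← ofReal_integral_eq_lintegral_ofReal (integrableOn_Ioi_rpow_of_lt (by linarith) ha),
    integral_Ioi_rpow_of_lt (by linarith) ha, sub_add_cancel, neg_div, div_neg]
  filter_upwards [ae_restrict_mem measurableSet_Ioi] with t ht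
  exact Real.rpow_nonneg (ha.trans ht).le _

variable {X : Type*} [MeasurableSpace X] {μ : Measure X} {f : X → ℝ} {p q B M N l : ℝ}

/-- The weak `L^p` bound `μ {f > t} ≤ B t ^ (-p) μ X`, normalised by the total mass. -/
def HasWeakLpBound (p B : ℝ) (f : X → ℝ) (μ : Measure X) : Prop :=
  ∀ t, 0 < t → μ {x | t < f x} ≤ ENNReal.ofReal (B * t ^ (-p)) * μ univ

namespace HasWeakLpBound

theorem const_mul (h : HasWeakLpBound p B f μ) (hl : 0 < l) :
    HasWeakLpBound p (B * l ^ p) (fun x => l * f x) μ := by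
  intro t ht
  have hdiv : B * l ^ p * t ^ (-p) = B * (t / l) ^ (-p) := by
    rw [Real.div_rpow ht.le hl.le, Real.rpow_neg hl.le, div_inv_eq_mul]
    ring
  simpa only [hdiv, div_lt_iff₀' hl] using h (t / l) (div_pos ht hl)

theorem measure_lt_mul_rpow_le (h : HasWeakLpBound p B f μ) (hB : 0 ≤ B) {t : ℝ} (ht : 0 < t) :
    μ {x | t < f x} * ENNReal.ofReal (t ^ (q - 1)) ≤
      ENNReal.ofReal B * μ univ * ENNReal.ofReal (t ^ (q - p - 1)) := by
  calc μ {x | t < f x} * ENNReal.ofReal (t ^ (q - 1))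
      ≤ ENNReal.ofReal (B * t ^ (-p)) * μ univ * ENNReal.ofReal (t ^ (q - 1)) := by
        gcongr
        exact h t ht
    _ = ENNReal.ofReal B * μ univ * ENNReal.ofReal (t ^ (-p) * t ^ (q - 1)) := by
        rw [ENNReal.ofReal_mul hB, ENNReal.ofReal_mul (by positivity)]
        ring
    _ = ENNReal.ofReal B * μ univ * ENNReal.ofReal (t ^ (q - p - 1)) := by
        rw [← Real.rpow_add ht]
        ring_nf

theorem lintegral_min_one_rpow_le_of_lt (h : HasWeakLpBound p B f μ) (hf0 : 0 ≤ f)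
    (hf : AEMeasurable f μ) (hq : 0 < q) (hpq : p < q) (hB : 0 ≤ B) :
    ∫⁻ x, ENNReal.ofReal (min 1 (f x) ^ q) ∂μ ≤ ENNReal.ofReal (q / (q - p) * B) * μ univ := by
  have hlayer : ∀ t ∈ Ioi (0 : ℝ), μ {x | t < min 1 (f x)} * ENNReal.ofReal (t ^ (q - 1)) ≤
      (Ioc 0 1).indicator
        (fun t => ENNReal.ofReal B * μ univ * ENNReal.ofReal (t ^ (q - p - 1))) t := by
    intro t ht
    by_cases ht1 : t < 1
    · rw [indicator_of_mem (mem_Ioc.2 ⟨ht, ht1.le⟩)]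
      simpa only [lt_min_iff, ht1, true_and] using h.measure_lt_mul_rpow_le hB ht
    · simp [ht1]
  rw [lintegral_rpow_eq_lintegral_meas_lt_mul μ
    (Eventually.of_forall fun x => le_min zero_le_one (hf0 x)) (aemeasurable_const.min hf) hq]
  calc ENNReal.ofReal q *
        ∫⁻ t in Ioi 0, μ {x | t < min 1 (f x)} * ENNReal.ofReal (t ^ (q - 1))
      ≤ ENNReal.ofReal q *
          ∫⁻ t in Ioc 0 1, ENNReal.ofReal B * μ univ * ENNReal.ofReal (t ^ (q - p - 1)) := by
        rw [← lintegral_indicator measurableSet_Ioc]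
        gcongr ENNReal.ofReal q * ?_
        exact (setLIntegral_mono' measurableSet_Ioi hlayer).trans
          (lintegral_mono' Measure.restrict_le_self le_rfl)
    _ = ENNReal.ofReal q * (ENNReal.ofReal B * μ univ * ENNReal.ofReal (q - p)⁻¹) := by
        rw [lintegral_const_mul _ (by fun_prop),
          setLIntegral_Ioc_rpow_sub_one (sub_pos.2 hpq) zero_le_one, Real.one_rpow, one_div]
    _ = ENNReal.ofReal (q / (q - p) * B) * μ univ := by
        rw [div_eq_mul_inv, ENNReal.ofReal_mul' hB, ENNReal.ofReal_mul hq.le]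
        ring

theorem lintegral_rpow_le_of_lt (h : HasWeakLpBound p B f μ) (hf0 : 0 ≤ f)
    (hf : AEMeasurable f μ) (hq : 0 < q) (hqp : q < p) (hB : 0 < B) :
    ∫⁻ x, ENNReal.ofReal (f x ^ q) ∂μ ≤
      ENNReal.ofReal ((1 + q / (p - q)) * B ^ (q / p)) * μ univ := by
  have hp : 0 < p := hq.trans hqp
  -- the level at which the trivial bound `μ {f > t} ≤ μ X` and the weak bound agree
  set a : ℝ := B ^ p⁻¹ with ha_def
  have ha : 0 < a := by positivity
  have haq : a ^ q = B ^ (q / p) := by rw [ha_def, ← Real.rpow_mul hB.le, inv_mul_eq_div]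
  have haB : B * a ^ (q - p) = a ^ q := by
    rw [Real.rpow_sub ha, ha_def, Real.rpow_inv_rpow hB.le hp.ne', mul_div_cancel₀ _ hB.ne']
  have hlow : ∫⁻ t in Ioc 0 a, μ {x | t < f x} * ENNReal.ofReal (t ^ (q - 1)) ≤
      μ univ * ENNReal.ofReal (a ^ q / q) := by
    rw [← setLIntegral_Ioc_rpow_sub_one hq ha.le, ← lintegral_const_mul _ (by fun_prop)]
    gcongr
    exact subset_univ _
  have hhigh : ∫⁻ t in Ioi a, μ {x | t < f x} * ENNReal.ofReal (t ^ (q - 1)) ≤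
      ENNReal.ofReal B * μ univ * ENNReal.ofReal (a ^ (q - p) / (p - q)) := by
    rw [← neg_sub q p, ← setLIntegral_Ioi_rpow_sub_one (sub_neg.2 hqp) ha,
      ← lintegral_const_mul _ (by fun_prop)]
    exact setLIntegral_mono' measurableSet_Ioi fun t ht =>
      h.measure_lt_mul_rpow_le hB.le (ha.trans ht)
  rw [lintegral_rpow_eq_lintegral_meas_lt_mul μ (Eventually.of_forall hf0) hf hq,
    ← Ioc_union_Ioi_eq_Ioi ha.le, ← haq]
  have hpq : 0 < p - q := sub_pos.2 hqp
  calc ENNReal.ofReal q *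
        ∫⁻ t in Ioc 0 a ∪ Ioi a, μ {x | t < f x} * ENNReal.ofReal (t ^ (q - 1))
      ≤ ENNReal.ofReal q * (μ univ * ENNReal.ofReal (a ^ q / q) +
          ENNReal.ofReal B * μ univ * ENNReal.ofReal (a ^ (q - p) / (p - q))) := by
        gcongr
        exact (lintegral_union_le _ _ _).trans (add_le_add hlow hhigh)
    _ = ENNReal.ofReal (q * (a ^ q / q) + q * (B * (a ^ (q - p) / (p - q)))) * μ univ := by
        rw [ENNReal.ofReal_add (by positivity) (by positivity), ENNReal.ofReal_mul hq.le,
          ENNReal.ofReal_mul hq.le, ENNReal.ofReal_mul hB.le]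
        ring
    _ = ENNReal.ofReal ((1 + q / (p - q)) * a ^ q) * μ univ := by
        rw [← mul_div_assoc B, haB]
        field_simp

theorem lintegral_min_one_rpow_le (h : HasWeakLpBound p B f μ) (hf0 : 0 ≤ f)
    (hf : AEMeasurable f μ) (hp : 0 < p) (hq : 0 < q) (hpq : p ≠ q) (hB : 0 < B) :
    ∫⁻ x, ENNReal.ofReal (min 1 (f x ^ q)) ∂μ ≤
      ENNReal.ofReal ((1 + q / |q - p|) * B ^ (min p q / p)) * μ univ := by
  rcases hpq.lt_or_gt with hlt | hgt
  · have hmin : ∀ x, min 1 (f x ^ q) = min 1 (f x) ^ q := fun x => by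
      rw [(Real.monotoneOn_rpow_Ici_of_exponent_nonneg hq.le).map_min (mem_Ici.2 zero_le_one)
        (hf0 x),
        Real.one_rpow]
    rw [min_eq_left hlt.le, div_self hp.ne', Real.rpow_one, abs_of_pos (sub_pos.2 hlt)]
    simp only [hmin]
    refine (h.lintegral_min_one_rpow_le_of_lt hf0 hf hq hlt hB.le).trans ?_
    gcongr
    exact le_add_of_nonneg_left zero_le_one
  · rw [min_eq_right hgt.le, abs_sub_comm, abs_of_pos (sub_pos.2 hgt)]
    refine le_trans (lintegral_mono fun x => ?_) (h.lintegral_rpow_le_of_lt hf0 hf hq hgt hB)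
    exact ENNReal.ofReal_le_ofReal (min_le_right _ _)

end HasWeakLpBound

theorem mul_one_add_rpow_rpow_div_le {r : ℝ} (hM : 0 ≤ M) (hN : 0 ≤ N) (hp : 0 < p) (hr : 0 ≤ r)
    (hrp : r ≤ p) : (M ^ p * (1 + N ^ p)) ^ (r / p) ≤ M ^ r * (1 + N ^ r) := by
  have hpow : ∀ {x : ℝ}, 0 ≤ x → (x ^ p) ^ (r / p) = x ^ r := fun hx => by
    rw [← Real.rpow_mul hx, mul_div_cancel₀ _ hp.ne']
  rw [Real.mul_rpow (by positivity) (by positivity), hpow hM]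
  gcongr
  simpa only [Real.one_rpow, hpow hN] using Real.rpow_add_le_add_rpow zero_le_one
    (Real.rpow_nonneg hN p) (div_nonneg hr hp.le) ((div_le_one hp).2 hrp)

theorem min_one_rpow_le_rpow {r : ℝ} (hl : 0 < l) (hr : 0 ≤ r) (hrq : r ≤ q) :
    min 1 (l ^ q) ≤ l ^ r := by
  rcases le_total 1 l with h1 | h1
  · exact (min_le_left _ _).trans (Real.one_le_rpow h1 hr)
  · exact (min_le_right _ _).trans (Real.rpow_le_rpow_of_exponent_ge hl h1 hrq)

theorem min_one_add_le {x y : ℝ} (hx : 0 ≤ x) (hy : 0 ≤ y) :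
    min 1 (x + y) ≤ min 1 x + min 1 y := by
  grind

theorem HasWeakLpBound.lintegral_min_one_mul_one_add_rpow_le
    (h : HasWeakLpBound p (M ^ p * (1 + N ^ p)) f μ) (hf0 : 0 ≤ f) (hf : AEMeasurable f μ)
    (hp : 0 < p) (hq : 0 < q) (hpq : p ≠ q) (hM : 1 ≤ M) (hN : 0 ≤ N) (hl : 0 < l) :
    ∫⁻ x, ENNReal.ofReal (min 1 (l ^ q * (1 + f x ^ q))) ∂μ ≤
      ENNReal.ofReal ((2 + q / |q - p|) * ((M * l) ^ min p q * (1 + N ^ min p q))) * μ univ := by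
  have hr : 0 < min p q := lt_min hp hq
  have hM0 : 0 < M := one_pos.trans_le hM
  set D : ℝ := (M * l) ^ min p q * (1 + N ^ min p q)
  have hconst : min 1 (l ^ q) ≤ D := by
    refine (min_one_rpow_le_rpow hl hr.le (min_le_right p q)).trans ?_
    calc l ^ min p q ≤ (M * l) ^ min p q := by
          gcongr
          exact le_mul_of_one_le_left hl.le hM
      _ ≤ D := le_mul_of_one_le_right (by positivity) (le_add_of_nonneg_right (by positivity))
  have hsplit : ∀ x, min 1 (l ^ q * (1 + f x ^ q)) ≤ D + min 1 ((l * f x) ^ q) := fun x => by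
    rw [mul_one_add, ← Real.mul_rpow hl.le (hf0 x)]
    exact (min_one_add_le (by positivity) (Real.rpow_nonneg (mul_nonneg hl.le (hf0 x)) q)).trans
      (by gcongr)
  have hvar : ∫⁻ x, ENNReal.ofReal (min 1 ((l * f x) ^ q)) ∂μ ≤
      ENNReal.ofReal ((1 + q / |q - p|) * D) * μ univ := by
    refine ((h.const_mul hl).lintegral_min_one_rpow_le (fun x => mul_nonneg hl.le (hf0 x))
      (hf.const_mul l) hp hq hpq (by positivity)).trans ?_
    gcongr
    rw [mul_right_comm, ← Real.mul_rpow hM0.le hl.le]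
    exact mul_one_add_rpow_rpow_div_le (by positivity) hN hp hr.le (min_le_left p q)
  calc ∫⁻ x, ENNReal.ofReal (min 1 (l ^ q * (1 + f x ^ q))) ∂μ
      ≤ ∫⁻ x, (ENNReal.ofReal D + ENNReal.ofReal (min 1 ((l * f x) ^ q))) ∂μ :=
        lintegral_mono fun x =>
          (ENNReal.ofReal_le_ofReal (hsplit x)).trans ENNReal.ofReal_add_le
    _ = ENNReal.ofReal D * μ univ + ∫⁻ x, ENNReal.ofReal (min 1 ((l * f x) ^ q)) ∂μ := by
        rw [lintegral_add_left measurable_const, lintegral_const]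
    _ ≤ ENNReal.ofReal D * μ univ + ENNReal.ofReal ((1 + q / |q - p|) * D) * μ univ := by gcongr
    _ = ENNReal.ofReal ((2 + q / |q - p|) * D) * μ univ := by
        rw [← add_mul, ← ENNReal.ofReal_add (by positivity) (by positivity)]
        ring_nf

theorem HasWeakLpBound.lintegral_min_one_mul_rpow_neg_le {M' t : ℝ}
    (h : HasWeakLpBound p (M ^ p * (1 + N ^ p)) f μ) (hf0 : 0 ≤ f) (hf : AEMeasurable f μ)
    (hp : 0 < p) (hq : 0 < q) (hpq : p ≠ q) (hM : 1 ≤ M) (hM' : 0 < M') (hN : 0 ≤ N) (ht : 0 < t) :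
    ∫⁻ x, ENNReal.ofReal (min 1 (M' ^ q * (1 + f x ^ q) * t ^ (-q))) ∂μ ≤
      ENNReal.ofReal ((2 + q / |q - p|) *
        ((M * M') ^ min p q * (1 + N ^ min p q) * t ^ (-min p q))) * μ univ := by
  have hleft (x : X) : M' ^ q * (1 + f x ^ q) * t ^ (-q) = (M' / t) ^ q * (1 + f x ^ q) := by
    rw [Real.div_rpow hM'.le ht.le, Real.rpow_neg ht.le]
    ring
  have hright : (M * M') ^ min p q * (1 + N ^ min p q) * t ^ (-min p q) =
      (M * (M' / t)) ^ min p q * (1 + N ^ min p q) := by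
    rw [← mul_div_assoc, Real.div_rpow (by positivity) ht.le, Real.rpow_neg ht.le]
    ring
  simpa only [hleft, hright] using
    h.lintegral_min_one_mul_one_add_rpow_le hf0 hf hp hq hpq hM hN (div_pos hM' ht)

theorem HasWeakLpBound.lintegral_le (h : HasWeakLpBound q (M ^ q * (1 + N ^ q)) f μ) (hf0 : 0 ≤ f)
    (hf : AEMeasurable f μ) (hq : 1 < q) (hM : 0 < M) (hN : 0 ≤ N) :
    ∫⁻ x, ENNReal.ofReal (f x) ∂μ ≤
      ENNReal.ofReal ((1 + 1 / (q - 1)) * (M * (1 + N))) * μ univ := by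
  have hint := h.lintegral_rpow_le_of_lt hf0 hf one_pos hq (by positivity)
  simp only [Real.rpow_one] at hint
  refine hint.trans ?_
  gcongr
  simpa only [Real.rpow_one] using
    mul_one_add_rpow_rpow_div_le hM.le hN (one_pos.trans hq) zero_le_one hq.le

end WeakLp

section Patch

open Metric

theorem isRegularDomain_ball (c : E m) {r : ℝ} (hr : 0 < r) : IsRegularDomain (ball c r) where
  isOpen := isOpen_ball
  isBounded := isBounded_ball
  isConnected := (convex_ball c r).isConnected (nonempty_ball.2 hr)
  volume_frontier := by
    rw [frontier_ball c hr.ne']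
    exact Measure.addHaar_sphere_of_ne_zero _ _ hr.ne'

theorem isPiecewiseAffine_affineMap {Ω : Set (E m)} (hΩ : IsRegularDomain Ω) (A : Mat d m)
    (b : E d) : IsPiecewiseAffine Ω (affineMap A b) := by
  refine ⟨{Ω}, countable_singleton Ω, pairwiseDisjoint_singleton Ω id, ?_, ?_⟩
  · rintro _ rfl
    exact ⟨hΩ, Subset.rfl, A, b, eqOn_refl _ _⟩
  · rw [sUnion_singleton, sdiff_self, measure_empty]

/-- A perturbation of class `C^α ∩ W^{1,1}`, piecewise affine, supported in the ball of
radius `r` around `c`; `g` is its weak gradient and `H` its Hölder constant. -/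
structure IsPatch (α H : ℝ≥0) (c : E m) (r : ℝ) (W : E m → E d) (g : E m → Mat d m) : Prop where
  w11 : IsW11WithGradient univ W g
  holder : HolderWith H α W
  eq_zero : ∀ x ∉ ball c r, W x = 0
  grad_eq_zero : ∀ x ∉ ball c r, g x = 0
  piecewise : IsPiecewiseAffine (ball c r) W

namespace IsPatch

variable {α H H' : ℝ≥0} {c : E m} {r : ℝ} {u W : E m → E d} {G g : E m → Mat d m}

theorem zero (hr : 0 < r) : IsPatch α H c r (0 : E m → E d) (0 : E m → Mat d m) where
  w11 := ⟨integrableOn_zero, fun _ _ => integrableOn_zero, fun _ _ _ _ _ _ => by simp⟩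
  holder := .zero
  eq_zero _ _ := rfl
  grad_eq_zero _ _ := rfl
  piecewise := by
    have hzero : affineMap (0 : Mat d m) 0 = 0 := by
      ext x i
      simp [affineMap_apply]
    exact hzero ▸ isPiecewiseAffine_affineMap (isRegularDomain_ball c hr) 0 0

theorem mono (h : IsPatch α H c r W g) (hH : H ≤ H') : IsPatch α H' c r W g :=
  { h with holder := h.holder.mono hH }

theorem exists_indicator_sub_affineMap (hα : 0 < α) (hα1 : α ≤ 1)
    (hpa : IsPiecewiseAffine (ball 0 1) u) (hw : IsW11WithGradient (ball 0 1) u G)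
    (hu : HolderOnWith H α u (closure (ball 0 1))) {A : Mat d m} {b : E d}
    (hbd : EqOn u (affineMap A b) (frontier (ball 0 1))) :
    ∃ H', IsPatch α H' 0 1 ((ball 0 1).indicator fun x => u x - affineMap A b x)
      ((ball 0 1).indicator fun x => G x - A) := by
  obtain ⟨H', hA⟩ := exists_holderOnWith_of_lipschitzWith (lipschitzWith_affineMap A b)
    (isBounded_ball (x := (0 : E m)) (r := 1)).closure hα1
  have hholder := holderWith_indicator isOpen_ball (holderOnWith_sub hu hA) fun x hx =>
    sub_eq_zero.2 (hbd hx)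
  refine ⟨H + H', ?_, hholder, fun x hx => indicator_of_notMem hx _,
    fun x hx => indicator_of_notMem hx _, ?_⟩
  · exact (hw.sub (.affineMap isBounded_ball A b)).indicator isExhaustingCutoff_ballCutoff
      measurableSet_ball (hholder.continuous hα)
  · obtain ⟨P, hPc, hPd, hP, hPv⟩ := hpa
    refine ⟨P, hPc, hPd, fun U hU => ?_, hPv⟩
    obtain ⟨hUreg, hUball, A', b', hA'⟩ := hP U hU
    refine ⟨hUreg, hUball, A' - A, b' - b, fun x hx => ?_⟩
    rw [indicator_of_mem (hUball hx), hA' hx, affineMap_sub_affineMap]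

theorem rescale (h : IsPatch α H 0 1 W g) (c : E m) (hr : 0 < r) :
    IsPatch α (H * (r ^ (1 - α : ℝ)).toNNReal) c r (fun x => r • W (unscale c hr x))
      (fun x => g (unscale c hr x)) where
  w11 := h.w11.rescale
  holder := by
    refine holderWith_of_dist_le fun x y => ?_
    calc dist (r • W (unscale c hr x)) (r • W (unscale c hr y))
        = r * dist (W (unscale c hr x)) (W (unscale c hr y)) := by
          rw [dist_smul₀, Real.norm_of_nonneg hr.le]
      _ ≤ r * (H * (r⁻¹ * dist x y) ^ (α : ℝ)) := by
          rw [← dist_unscale c hr]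
          gcongr
          exact h.holder.dist_le _ _
      _ = H * r ^ (1 - α : ℝ) * dist x y ^ (α : ℝ) := by
          rw [Real.mul_rpow (by positivity) dist_nonneg, Real.inv_rpow hr.le, Real.rpow_sub hr,
            Real.rpow_one]
          ring
      _ = _ := by rw [NNReal.coe_mul, Real.coe_toNNReal _ (by positivity)]
  eq_zero x hx := by
    rw [← preimage_unscale_ball c hr] at hx
    rw [h.eq_zero _ hx, smul_zero]
  grad_eq_zero x hx := by
    rw [← preimage_unscale_ball c hr] at hx
    exact h.grad_eq_zero _ hx
  piecewise := preimage_unscale_ball c hr ▸ h.piecewise.rescale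

theorem exists_forall_rescale_one (h : IsPatch α H 0 1 W g) (hα : α < 1) :
    ∃ R, 0 < R ∧ ∀ c r (hr : 0 < r), r < R →
      IsPatch α 1 c r (fun x => r • W (unscale c hr x)) (fun x => g (unscale c hr x)) := by
  have hα' : (0 : ℝ) < 1 - α := sub_pos.2 (by exact_mod_cast hα)
  have hlim : Tendsto (fun r : ℝ => (H : ℝ) * r ^ (1 - α : ℝ)) (𝓝 0) (𝓝 0) := by
    simpa only [Real.zero_rpow hα'.ne', mul_zero] using
      ((Real.continuous_rpow_const hα'.le).tendsto 0).const_mul (H : ℝ)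
  obtain ⟨R, hR, hsmall⟩ := Metric.eventually_nhds_iff.1 (hlim.eventually_le_const one_pos)
  refine ⟨R, hR, fun c r hr hrR => (h.rescale c hr).mono ?_⟩
  rw [← NNReal.coe_le_coe, NNReal.coe_mul, Real.coe_toNNReal _ (by positivity)]
  exact hsmall (by rwa [Real.dist_0_eq_abs, abs_of_pos hr])

end IsPatch

end Patch

section ReducingPatch

open Metric

/-- The two quantitative conclusions of `ReductionBound K K' p C` about a gradient field `G` on `Ω`,
for boundary data with gradient `A`. -/
structure HasReductionEstimates (K' : Set (Mat d m)) (p C ε s : ℝ) (A : Mat d m) (Ω : Set (E m))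
    (G : E m → Mat d m) : Prop where
  setLIntegral_le : ∫⁻ x in {x ∈ Ω | G x ∉ K'}, ENNReal.ofReal ((1 + matNorm (G x)) ^ s) ≤
    ENNReal.ofReal ε * volume Ω
  volume_lt_le : ∀ t : ℝ, 0 < t → volume {x ∈ Ω | t < matNorm (G x)} ≤
    ENNReal.ofReal (C * (1 + matNorm A ^ p) * t ^ (-p)) * volume Ω

namespace HasReductionEstimates

variable {K' : Set (Mat d m)} {p C ε s : ℝ} {A : Mat d m} {Ω : Set (E m)} {G G' : E m → Mat d m}

theorem congr (h : HasReductionEstimates K' p C ε s A Ω G) (hΩ : MeasurableSet Ω)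
    (hG : EqOn G G' Ω) : HasReductionEstimates K' p C ε s A Ω G' where
  setLIntegral_le := by
    have hset : {x ∈ Ω | G' x ∉ K'} = {x ∈ Ω | G x ∉ K'} :=
      Set.ext fun x => and_congr_right fun hx => by rw [hG hx]
    rw [hset]
    refine (lintegral_congr_ae (ae_restrict_of_ae_restrict_of_subset (sep_subset _ _) ?_)).trans_le
      h.setLIntegral_le
    filter_upwards [ae_restrict_mem hΩ] with x hx
    rw [hG hx]
  volume_lt_le t ht := by
    have hset : {x ∈ Ω | t < matNorm (G' x)} = {x ∈ Ω | t < matNorm (G x)} :=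
      Set.ext fun x => and_congr_right fun hx => by rw [hG hx]
    exact hset ▸ h.volume_lt_le t ht

theorem comp_unscale (h : HasReductionEstimates K' p C ε s A Ω G) (c : E m) {r : ℝ} (hr : 0 < r) :
    HasReductionEstimates K' p C ε s A (unscale c hr ⁻¹' Ω) fun x => G (unscale c hr x) where
  setLIntegral_le := by
    refine (setLIntegral_preimage_unscale c hr {x ∈ Ω | G x ∉ K'} fun x =>
      ENNReal.ofReal ((1 + matNorm (G x)) ^ s)).trans_le ?_
    rw [volume_preimage_unscale, mul_left_comm]
    gcongr
    exact h.setLIntegral_le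
  volume_lt_le t ht := by
    refine (volume_preimage_unscale c hr {x ∈ Ω | t < matNorm (G x)}).trans_le ?_
    rw [volume_preimage_unscale, mul_left_comm]
    gcongr
    exact h.volume_lt_le t ht

theorem hasWeakLpBound (h : HasReductionEstimates K' p C ε s A Ω G) (hΩ : MeasurableSet Ω) :
    HasWeakLpBound p (C * (1 + matNorm A ^ p)) (fun x => matNorm (G x)) (volume.restrict Ω) := by
  intro t ht
  rw [Measure.restrict_apply' hΩ, inter_comm, Measure.restrict_apply_univ]
  exact h.volume_lt_le t ht

end HasReductionEstimates

/-- A patch to be inserted where the gradient is `A`: it realises the reduction of `K'` to `K''` if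
`A ∈ K'`, and leaves the gradient unchanged otherwise. -/
structure IsReducingPatch (K' K'' : Set (Mat d m)) (q C ε s : ℝ) (α : ℝ≥0) (A : Mat d m) (c : E m)
    (r : ℝ) (W : E m → E d) (g : E m → Mat d m) : Prop extends IsPatch α 1 c r W g where
  estimates : A ∈ K' → HasReductionEstimates K'' q C ε s A (ball c r) fun x => A + g x
  grad_eq_zero_of_notMem : A ∉ K' → g = 0

theorem ReductionBound.exists_isReducingPatch {K' K'' : Set (Mat d m)} {q C ε s : ℝ} {α : ℝ≥0}
    (h : ReductionBound K' K'' q C) (A : Mat d m) (hε : 0 < ε) (hε1 : ε < 1) (hα : 0 < α)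
    (hα1 : α < 1) (hs : 1 < s) :
    ∃ R : ℝ, 0 < R ∧ ∀ (c : E m) (r : ℝ), 0 < r → r < R →
      ∃ (W : E m → E d) (g : E m → Mat d m), IsReducingPatch K' K'' q C ε s α A c r W g := by
  by_cases hA : A ∈ K'
  · obtain ⟨u, G, hpa, hw, ⟨H, hH⟩, hbd, herr, hweak⟩ :=
      h A hA 0 ε α s hε hε1 hα hα1 hs _ (isRegularDomain_ball (0 : E m) one_pos)
    obtain ⟨H', hpatch⟩ := IsPatch.exists_indicator_sub_affineMap hα hα1.le hpa hw hH hbd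
    obtain ⟨R, hR, hrescale⟩ := hpatch.exists_forall_rescale_one hα1
    have hest : HasReductionEstimates K'' q C ε s A (ball 0 1)
        fun x => A + (ball 0 1).indicator (fun x => G x - A) x :=
      HasReductionEstimates.congr ⟨herr.le, hweak⟩ measurableSet_ball fun x hx => by
        rw [indicator_of_mem hx, add_sub_cancel]
    exact ⟨R, hR, fun c r hr hrR => ⟨_, _, hrescale c r hr hrR,
      fun _ => preimage_unscale_ball c hr ▸ hest.comp_unscale c hr, fun hA' => (hA' hA).elim⟩⟩
  · exact ⟨1, one_pos, fun c r hr _ => ⟨0, 0, .zero hr, fun hA' => (hA hA').elim, fun _ => rfl⟩⟩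

/-- The integrand `(1 + |B|) ^ s` of the error term, restricted to the matrices outside `K`. -/
noncomputable def excess (K : Set (Mat d m)) (s : ℝ) : Mat d m → ℝ≥0∞ :=
  Kᶜ.indicator fun B => ENNReal.ofReal ((1 + matNorm B) ^ s)

theorem setLIntegral_excess_le {K : Set (Mat d m)} {s : ℝ} {Ω : Set (E m)} (hΩ : MeasurableSet Ω)
    (G : E m → Mat d m) : ∫⁻ x in Ω, excess K s (G x) ≤
      ∫⁻ x in {x ∈ Ω | G x ∉ K}, ENNReal.ofReal ((1 + matNorm (G x)) ^ s) := by
  have hrestrict : volume.restrict {x ∈ Ω | G x ∉ K} =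
      (volume.restrict Ω).restrict {x | G x ∉ K} := by
    rw [Measure.restrict_restrict' hΩ, inter_comm]
    rfl
  rw [hrestrict]
  exact lintegral_indicator_le (fun x => ENNReal.ofReal ((1 + matNorm (G x)) ^ s)) {x | G x ∉ K}

theorem excess_mono {K : Set (Mat d m)} {s s' : ℝ} (hs : s ≤ s') : excess K s ≤ excess K s' :=
  fun B => indicator_le_indicator (ENNReal.ofReal_le_ofReal (Real.rpow_le_rpow_of_exponent_le
    (le_add_of_nonneg_right (matNorm_nonneg B)) hs))

theorem one_le_rpow_neg_mul_excess {K : Set (Mat d m)} {B : Mat d m} (hB : B ∉ K) {e s t : ℝ}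
    (he : 0 ≤ e) (hes : e ≤ s) (ht : 0 < t) (htB : t < matNorm B) :
    1 ≤ ENNReal.ofReal (t ^ (-e)) * excess K s B := by
  rw [excess, indicator_of_mem (mem_compl hB), ← ENNReal.ofReal_mul (by positivity),
    ENNReal.one_le_ofReal]
  calc 1 = t ^ (-e) * t ^ e := by rw [← Real.rpow_add ht, neg_add_cancel, Real.rpow_zero]
    _ ≤ t ^ (-e) * (1 + matNorm B) ^ e := by gcongr; linarith
    _ ≤ t ^ (-e) * (1 + matNorm B) ^ s := by gcongr; linarith

namespace IsReducingPatch

variable {K' K'' : Set (Mat d m)} {q C M ε s : ℝ} {α : ℝ≥0} {A : Mat d m} {c : E m} {r : ℝ}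
  {W : E m → E d} {g : E m → Mat d m}

theorem setLIntegral_le (h : IsReducingPatch K' K'' q C ε s α A c r W g) :
    ∫⁻ x in {x ∈ ball c r | A + g x ∈ K''ᶜ}, ENNReal.ofReal ((1 + matNorm (A + g x)) ^ s) ≤
      (ENNReal.ofReal ε + excess K' s A) * volume (ball c r) := by
  by_cases hA : A ∈ K'
  · refine (h.estimates hA).setLIntegral_le.trans ?_
    gcongr
    exact le_self_add
  · simp only [h.grad_eq_zero_of_notMem hA, Pi.zero_apply, add_zero, setLIntegral_const, excess,
      indicator_of_mem (mem_compl hA)]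
    gcongr
    · exact le_add_self
    · exact sep_subset _ _

theorem volume_lt_le (h : IsReducingPatch K' K'' q C ε s α A c r W g) {e s' t : ℝ} (he : 0 ≤ e)
    (hes : e ≤ s') (ht : 0 < t) :
    volume {x ∈ ball c r | t < matNorm (A + g x)} ≤
      (ENNReal.ofReal (min 1 (C * (1 + matNorm A ^ q) * t ^ (-q))) +
        ENNReal.ofReal (t ^ (-e)) * excess K' s' A) * volume (ball c r) := by
  by_cases hA : A ∈ K'
  · calc volume {x ∈ ball c r | t < matNorm (A + g x)}
        ≤ ENNReal.ofReal (min 1 (C * (1 + matNorm A ^ q) * t ^ (-q))) * volume (ball c r) := by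
          rw [ENNReal.ofReal_min, ENNReal.ofReal_one]
          rcases min_choice 1 (ENNReal.ofReal (C * (1 + matNorm A ^ q) * t ^ (-q))) with hmin | hmin
          · rw [hmin, one_mul]
            exact measure_mono (sep_subset _ _)
          · rw [hmin]
            exact (h.estimates hA).volume_lt_le t ht
      _ ≤ _ := by
          gcongr
          exact le_self_add
  · simp only [h.grad_eq_zero_of_notMem hA, Pi.zero_apply, add_zero]
    by_cases htA : t < matNorm A
    · refine (measure_mono (sep_subset _ _)).trans (le_mul_of_one_le_left' ?_)
      exact (one_le_rpow_neg_mul_excess hA he hes ht htA).trans le_add_self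
    · simp only [htA, and_false, ofPred_false, measure_empty, zero_le]

theorem integrable_grad_apply (h : IsReducingPatch K' K'' q C ε s α A c r W g) (i : Fin d)
    (j : Fin m) : Integrable fun x => g x i j :=
  integrableOn_univ.1 (h.w11.integrableOn_grad i j)

theorem setLIntegral_matNorm_le (h : IsReducingPatch K' K'' q (M ^ q) ε s α A c r W g) (hq : 1 < q)
    (hM : 1 ≤ M) : ∫⁻ x in ball c r, ENNReal.ofReal (matNorm (A + g x)) ≤
      ENNReal.ofReal ((1 + 1 / (q - 1)) * (M * (1 + matNorm A))) * volume (ball c r) := by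
  have hA0 := matNorm_nonneg A
  by_cases hA : A ∈ K'
  · have hmeas : AEMeasurable (fun x => matNorm (A + g x)) (volume.restrict (ball c r)) :=
      aemeasurable_matNorm fun i j =>
        aemeasurable_const.add (h.integrable_grad_apply i j).aemeasurable.restrict
    simpa only [Measure.restrict_apply_univ] using
      ((h.estimates hA).hasWeakLpBound measurableSet_ball).lintegral_le
        (fun x => matNorm_nonneg (A + g x)) hmeas hq (one_pos.trans_le hM) hA0
  · simp only [h.grad_eq_zero_of_notMem hA, Pi.zero_apply, add_zero, setLIntegral_const]
    gcongr
    have hθ : 0 ≤ 1 / (q - 1) := one_div_nonneg.2 (sub_pos.2 hq).le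
    calc matNorm A ≤ 1 + matNorm A := le_add_of_nonneg_left zero_le_one
      _ ≤ M * (1 + matNorm A) := le_mul_of_one_le_left (by positivity) hM
      _ ≤ _ := le_mul_of_one_le_left (by positivity) (le_add_of_nonneg_right hθ)

end IsReducingPatch

end ReducingPatch

section AffineBallPartition

open Metric

theorem exists_disjoint_balls_covering_ae {U : Set (E m)} (hU : IsOpen U) {R : ℝ} (hR : 0 < R) :
    ∃ (t : Set (E m)) (r : E m → ℝ), t.Countable ∧
      (∀ x ∈ t, 0 < r x ∧ r x < R ∧ ball x (r x) ⊆ U) ∧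
      t.PairwiseDisjoint (fun x => ball x (r x)) ∧
      volume (U \ ⋃ x ∈ t, ball x (r x)) = 0 := by
  obtain ⟨t, r, htc, -, hr, hcov, hdisj⟩ := Besicovitch.exists_disjoint_closedBall_covering_ae
    (volume : Measure (E m)) (fun x => {ρ | closedBall x ρ ⊆ U}) U (fun x hx δ hδ => by
      obtain ⟨ρ, hρ, hρU⟩ := nhds_basis_closedBall.mem_iff.1 (hU.mem_nhds hx)
      exact ⟨min ρ (δ / 2), (closedBall_subset_closedBall (min_le_left _ _)).trans hρU,
        lt_min hρ (half_pos hδ), (min_le_right _ _).trans_lt (half_lt_self hδ)⟩)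
    (fun _ => R) fun _ _ => hR
  refine ⟨t, r, htc, fun x hx => ⟨(hr x hx).2.1, (hr x hx).2.2,
    ball_subset_closedBall.trans (hr x hx).1⟩, fun x hx y hy hxy =>
    (hdisj hx hy hxy).mono ball_subset_closedBall ball_subset_closedBall, ?_⟩
  have hsphere : volume (⋃ x ∈ t, sphere x (r x)) = 0 :=
    (measure_biUnion_null_iff htc).2 fun x hx =>
      Measure.addHaar_sphere_of_ne_zero _ _ (hr x hx).2.1.ne'
  refine measure_mono_null ?_ (measure_union_null hcov hsphere)
  rintro x ⟨hxU, hxball⟩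
  simp only [mem_union, Set.mem_sdiff, mem_iUnion₂, not_exists] at hxball ⊢
  by_cases hx : ∃ y, ∃ _ : y ∈ t, x ∈ closedBall y (r y)
  · obtain ⟨y, hy, hxy⟩ := hx
    exact .inr ⟨y, hy, (mem_closedBall.1 hxy).antisymm (not_lt.1 (hxball y hy))⟩
  · exact .inl ⟨hxU, fun y hy hxy => hx ⟨y, hy, hxy⟩⟩

/-- A partition of `Ω`, up to a null set, into the balls `ball (c k) (r k)`, on each of which `u` is
affine with gradient `A k`. -/
structure IsAffineBallPartition {ι : Type*} (Ω : Set (E m)) (u : E m → E d) (c : ι → E m)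
    (r : ι → ℝ) (A : ι → Mat d m) : Prop where
  radius_pos : ∀ k, 0 < r k
  ball_subset : ∀ k, ball (c k) (r k) ⊆ Ω
  disjoint : Pairwise fun k l => Disjoint (ball (c k) (r k)) (ball (c l) (r l))
  eqOn : ∀ k, ∃ b, EqOn u (affineMap (A k) b) (ball (c k) (r k))
  volume_sdiff : volume (Ω \ ⋃ k, ball (c k) (r k)) = 0

theorem IsPiecewiseAffine.exists_isAffineBallPartition {Ω : Set (E m)} {u : E m → E d}
    (hu : IsPiecewiseAffine Ω u) {R : Mat d m → ℝ} (hR : ∀ A, 0 < R A) :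
    ∃ (ι : Type) (_ : Countable ι) (c : ι → E m) (r : ι → ℝ) (A : ι → Mat d m),
      IsAffineBallPartition Ω u c r A ∧ ∀ k, r k < R (A k) := by
  obtain ⟨P, hPc, hPd, hP, hPv⟩ := hu
  have hPaff : ∀ U ∈ P, ∃ (A : Mat d m) (b : E d), EqOn u (affineMap A b) U :=
    fun U hU => (hP U hU).2.2
  choose! A b hA using hPaff
  choose! t r htc ht htd htv using fun U hU =>
    exists_disjoint_balls_covering_ae (hP U hU).1.isOpen (hR (A U))
  have : Countable P := hPc.to_subtype
  have (U : P) : Countable (t U) := (htc U U.2).to_subtype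
  refine ⟨Σ U : P, t U, inferInstance, fun k => k.2, fun k => r k.1 k.2, fun k => A k.1,
    ⟨fun k => (ht k.1 k.1.2 k.2 k.2.2).1, fun k => ?_, ?_, fun k => ?_, ?_⟩,
    fun k => (ht k.1 k.1.2 k.2 k.2.2).2.1⟩
  · exact (ht k.1 k.1.2 k.2 k.2.2).2.2.trans (hP k.1 k.1.2).2.1
  · rintro ⟨⟨U, hU⟩, ⟨x, hx⟩⟩ ⟨⟨U', hU'⟩, ⟨y, hy⟩⟩ hne
    by_cases hUU' : U = U'
    · subst hUU'
      exact htd U hU hx hy fun hxy => hne (by subst hxy; rfl)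
    · exact (hPd hU hU' hUU').mono (ht U hU x hx).2.2 (ht U' hU' y hy).2.2
  · exact ⟨b k.1, (hA k.1 k.1.2).mono (ht k.1 k.1.2 k.2 k.2.2).2.2⟩
  · refine measure_mono_null ?_
      (measure_union_null hPv ((measure_biUnion_null_iff hPc).2 htv))
    rintro x ⟨hxΩ, hxball⟩
    by_cases hxP : x ∈ ⋃₀ P
    · obtain ⟨U, hU, hxU⟩ := hxP
      refine .inr (mem_biUnion hU ⟨hxU, fun hxt => hxball ?_⟩)
      obtain ⟨y, hy, hxy⟩ := mem_iUnion₂.1 hxt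
      exact mem_iUnion.2 ⟨⟨⟨U, hU⟩, ⟨y, hy⟩⟩, hxy⟩
    · exact .inl ⟨hxΩ, hxP⟩

theorem tsum_apply_of_mem {ι X F : Type*} [AddCommMonoid F] [TopologicalSpace F] {U : ι → Set X}
    (hU : Pairwise fun k l => Disjoint (U k) (U l)) {f : ι → X → F} (hf : ∀ k, ∀ x ∉ U k, f k x = 0)
    {k : ι} {x : X} (hx : x ∈ U k) : ∑' l, f l x = f k x :=
  tsum_eq_single k fun l hl => hf l x fun hxl => disjoint_left.1 (hU hl) hxl hx

namespace IsAffineBallPartition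

variable {Ω : Set (E m)} {u : E m → E d} {G : E m → Mat d m} {ι : Type*}
  {c : ι → E m} {r : ι → ℝ} {A : ι → Mat d m} {W : ι → E m → E d} {g : ι → E m → Mat d m}

theorem iUnion_ball_ae_eq (h : IsAffineBallPartition Ω u c r A) :
    (⋃ k, ball (c k) (r k) : Set (E m)) =ᵐ[volume] Ω :=
  (iUnion_subset h.ball_subset).eventuallyLE.antisymm (ae_le_set.2 h.volume_sdiff)

variable [Countable ι]

theorem grad_ae_eq (h : IsAffineBallPartition Ω u c r A) (hw : IsW11WithGradient Ω u G) :
    ∀ᵐ x, ∀ k, x ∈ ball (c k) (r k) → G x = A k :=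
  ae_all_iff.2 fun k =>
    let ⟨_, hb⟩ := h.eqOn k
    hw.ae_eq_of_eqOn_affineMap isOpen_ball isBounded_ball (h.ball_subset k) hb

theorem tsum_mul_volume (h : IsAffineBallPartition Ω u c r A) (hw : IsW11WithGradient Ω u G)
    (Φ : Mat d m → ℝ≥0∞) :
    ∑' k, Φ (A k) * volume (ball (c k) (r k)) = ∫⁻ x in Ω, Φ (G x) := by
  rw [← setLIntegral_congr h.iUnion_ball_ae_eq,
    lintegral_iUnion (fun _ => measurableSet_ball) h.disjoint]
  refine tsum_congr fun k => ?_
  rw [← setLIntegral_const]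
  refine setLIntegral_congr_fun_ae measurableSet_ball ?_
  filter_upwards [h.grad_ae_eq hw] with x hx hxk
  rw [hx k hxk]

theorem grad_add_tsum_ae_eq (h : IsAffineBallPartition Ω u c r A) (hw : IsW11WithGradient Ω u G)
    (hg : ∀ k, ∀ x ∉ ball (c k) (r k), g k x = 0) :
    ∀ᵐ x, ∀ k, x ∈ ball (c k) (r k) → G x + ∑' l, g l x = A k + g k x := by
  filter_upwards [h.grad_ae_eq hw] with x hx k hxk
  rw [hx k hxk, tsum_apply_of_mem h.disjoint hg hxk]

theorem setLIntegral_grad_add_tsum_le (h : IsAffineBallPartition Ω u c r A)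
    (hw : IsW11WithGradient Ω u G) (hg : ∀ k, ∀ x ∉ ball (c k) (r k), g k x = 0)
    {F Φ : Mat d m → ℝ≥0∞} {T : Set (Mat d m)}
    (hF : ∀ k, ∫⁻ x in {x ∈ ball (c k) (r k) | A k + g k x ∈ T}, F (A k + g k x) ≤
      Φ (A k) * volume (ball (c k) (r k))) :
    ∫⁻ x in {x ∈ Ω | G x + ∑' k, g k x ∈ T}, F (G x + ∑' k, g k x) ≤ ∫⁻ x in Ω, Φ (G x) := by
  have hball := h.grad_add_tsum_ae_eq hw hg
  have hset : {x ∈ Ω | G x + ∑' k, g k x ∈ T} ≤ᵐ[volume]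
      (⋃ k, {x ∈ ball (c k) (r k) | A k + g k x ∈ T} : Set (E m)) := by
    filter_upwards [hball, h.iUnion_ball_ae_eq.mem_iff] with x hx hcover hxT
    obtain ⟨k, hxk⟩ := mem_iUnion.1 (hcover.2 hxT.1)
    exact mem_iUnion.2 ⟨k, hxk, hx k hxk ▸ hxT.2⟩
  rw [← h.tsum_mul_volume hw]
  refine (lintegral_mono_set' hset).trans ((lintegral_iUnion_le _ _).trans
    (ENNReal.tsum_le_tsum fun k => le_trans (le_of_eq ?_) (hF k)))
  refine lintegral_congr_ae (ae_restrict_of_ae_restrict_of_subset (sep_subset _ _) ?_)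
  rw [ae_restrict_iff' measurableSet_ball]
  filter_upwards [hball] with x hx hxk
  rw [hx k hxk]

end IsAffineBallPartition

end AffineBallPartition

section Gluing

open Metric

theorem setIntegral_eq_tsum {ι X : Type*} [Countable ι] [MeasurableSpace X] {μ : Measure X}
    {U : ι → Set X} {Ω : Set X} (hUm : ∀ k, MeasurableSet (U k))
    (hU : Pairwise fun k l => Disjoint (U k) (U l)) (hUΩ : (⋃ k, U k : Set X) =ᵐ[μ] Ω)
    {F : X → ℝ} (hF : IntegrableOn F Ω μ) {f : ι → X → ℝ} (hf : ∀ k, ∀ x ∉ U k, f k x = 0)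
    (hFf : ∀ k, EqOn F (f k) (U k)) : ∫ x in Ω, F x ∂μ = ∑' k, ∫ x, f k x ∂μ := by
  rw [← setIntegral_congr_set hUΩ,
    integral_iUnion hUm hU (hF.congr_set_ae hUΩ)]
  refine tsum_congr fun k => ?_
  rw [setIntegral_congr_fun (hUm k) (hFf k), setIntegral_eq_integral_of_forall_compl_eq_zero (hf k)]

theorem isW11WithGradient_tsum {ι : Type*} [Countable ι] {U : ι → Set (E m)} {Ω : Set (E m)}
    {W : ι → E m → E d} {g : ι → E m → Mat d m} (hUm : ∀ k, MeasurableSet (U k))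
    (hU : Pairwise fun k l => Disjoint (U k) (U l)) (hUΩ : (⋃ k, U k : Set (E m)) =ᵐ[volume] Ω)
    (h : ∀ k, IsW11WithGradient univ (W k) (g k)) (hW : ∀ k, ∀ x ∉ U k, W k x = 0)
    (hg : ∀ k, ∀ x ∉ U k, g k x = 0) (hWi : IntegrableOn (fun x => ∑' k, W k x) Ω)
    (hgi : ∀ i j, IntegrableOn (fun x => (∑' k, g k x) i j) Ω) :
    IsW11WithGradient Ω (fun x => ∑' k, W k x) fun x => ∑' k, g k x where
  integrableOn := hWi
  integrableOn_grad := hgi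
  integral_eq i j φ hφ hφc _ := by
    have hleft : ∫ x in Ω, (∑' k, W k x) i * fderiv ℝ φ x (EuclideanSpace.single j 1) =
        ∑' k, ∫ x, W k x i * fderiv ℝ φ x (EuclideanSpace.single j 1) :=
      setIntegral_eq_tsum hUm hU hUΩ (integrable_mul_testFunction (hWi.eval_piLp i)
        (continuous_fderiv_testFunction hφ _) (hφc.fderiv_apply (𝕜 := ℝ) _))
        (fun k x hx => by simp only [hW k x hx, PiLp.zero_apply, zero_mul])
        fun k x hx => by simp only [tsum_apply_of_mem hU hW hx]
    have hright : ∫ x in Ω, (∑' k, g k x) i j * φ x = ∑' k, ∫ x, g k x i j * φ x :=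
      setIntegral_eq_tsum hUm hU hUΩ
        (integrable_mul_testFunction (hgi i j) hφ.continuous hφc)
        (fun k x hx => by simp only [hg k x hx, Matrix.zero_apply, zero_mul])
        fun k x hx => by simp only [tsum_apply_of_mem hU hg hx]
    rw [hleft, hright, ← tsum_neg]
    exact tsum_congr fun k => by
      simpa only [Measure.restrict_univ] using (h k).integral_eq i j φ hφ hφc (subset_univ _)

theorem aestronglyMeasurable_tsum_apply {ι : Type*} [Countable ι] {U : ι → Set (E m)}
    {Ω : Set (E m)} {g : ι → E m → Mat d m} (hUm : ∀ k, MeasurableSet (U k))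
    (hU : Pairwise fun k l => Disjoint (U k) (U l)) (hUΩ : (⋃ k, U k : Set (E m)) =ᵐ[volume] Ω)
    (hg : ∀ k, ∀ x ∉ U k, g k x = 0) (i : Fin d) (j : Fin m)
    (hgm : ∀ k, AEStronglyMeasurable fun x => g k x i j) :
    AEStronglyMeasurable (fun x => (∑' k, g k x) i j) (volume.restrict Ω) := by
  rw [← Measure.restrict_congr_set hUΩ, aestronglyMeasurable_iUnion_iff]
  refine fun k => (hgm k).restrict.congr ?_
  filter_upwards [ae_restrict_mem (hUm k)] with x hx
  rw [tsum_apply_of_mem hU hg hx]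

theorem integrableOn_holderWith {Ω : Set (E m)} {α H : ℝ≥0} {W : E m → E d} (hα : 0 < α)
    (hW : HolderWith H α W) (hΩ : Bornology.IsBounded Ω) : IntegrableOn W Ω :=
  ((hW.continuous hα).locallyIntegrable.integrableOn_isCompact
    hΩ.isCompact_closure).mono_set subset_closure

theorem IsAffineBallPartition.isPiecewiseAffine_add_tsum {Ω : Set (E m)} {u : E m → E d}
    {ι : Type*} [Countable ι] {c : ι → E m} {r : ι → ℝ} {A : ι → Mat d m} {W : ι → E m → E d}
    (h : IsAffineBallPartition Ω u c r A) (hW : ∀ k, ∀ x ∉ ball (c k) (r k), W k x = 0)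
    (hpa : ∀ k, IsPiecewiseAffine (ball (c k) (r k)) (W k)) :
    IsPiecewiseAffine Ω fun x => u x + ∑' k, W k x := by
  choose P hPc hPd hP hPv using hpa
  have hsub : ∀ k, ∀ U ∈ P k, U ⊆ ball (c k) (r k) := fun k U hU => (hP k U hU).2.1
  refine ⟨⋃ k, P k, countable_iUnion hPc, ?_, ?_, ?_⟩
  · intro U hU U' hU' hne
    obtain ⟨k, hk⟩ := mem_iUnion.1 hU
    obtain ⟨l, hl⟩ := mem_iUnion.1 hU'
    by_cases hkl : k = l
    · subst hkl
      exact hPd k hk hl hne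
    · exact (h.disjoint hkl).mono (hsub k U hk) (hsub l U' hl)
  · intro U hU
    obtain ⟨k, hk⟩ := mem_iUnion.1 hU
    obtain ⟨hreg, hUball, B, b, hb⟩ := hP k U hk
    obtain ⟨b', hb'⟩ := h.eqOn k
    refine ⟨hreg, hUball.trans (h.ball_subset k), A k + B, b' + b, fun x hx => ?_⟩
    simp only [tsum_apply_of_mem h.disjoint hW (hUball hx), hb hx, hb' (hUball hx),
      affineMap_add_affineMap]
  · refine measure_mono_null ?_ (measure_union_null h.volume_sdiff (measure_iUnion_null hPv))
    rintro x ⟨hxΩ, hx⟩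
    by_cases hxball : x ∈ ⋃ k, ball (c k) (r k)
    · obtain ⟨k, hxk⟩ := mem_iUnion.1 hxball
      refine .inr (mem_iUnion.2 ⟨k, hxk, fun hxP => hx ?_⟩)
      exact sUnion_mono (subset_iUnion P k) hxP
    · exact .inl ⟨hxΩ, hxball⟩

namespace IsAffineBallPartition

variable {K K' K'' : Set (Mat d m)} {Ω : Set (E m)} {u : E m → E d} {G : E m → Mat d m}
  {ι : Type*} {c : ι → E m} {r : ι → ℝ} {A : ι → Mat d m} {p q C M M' N ε δ s s' : ℝ}
  {α : ℝ≥0} {W : ι → E m → E d} {g : ι → E m → Mat d m}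

theorem holderWith_tsum (h : IsAffineBallPartition Ω u c r A)
    (hp : ∀ k, IsReducingPatch K' K'' q C δ s α (A k) (c k) (r k) (W k) (g k)) :
    HolderWith (2 * 1) α fun x => ∑' k, W k x :=
  holderWith_tsum_of_disjoint_support (fun k => (hp k).holder) fun k l hkl =>
    (h.disjoint hkl).mono (Function.support_subset_iff'.2 (hp k).eq_zero)
      (Function.support_subset_iff'.2 (hp l).eq_zero)

theorem tsum_eq_zero_of_mem_frontier (h : IsAffineBallPartition Ω u c r A) (hΩ : IsOpen Ω)
    (hW : ∀ k, ∀ x ∉ ball (c k) (r k), W k x = 0) {x : E m} (hx : x ∈ frontier Ω) :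
    ∑' k, W k x = 0 := by
  have hxΩ : x ∉ Ω := (hΩ.frontier_eq ▸ hx).2
  have hWx (k) : W k x = 0 := hW k x fun hxk => hxΩ (h.ball_subset k hxk)
  simp only [hWx, tsum_zero]

variable [Countable ι]

theorem integrableOn_grad_add_tsum_apply (h : IsAffineBallPartition Ω u c r A)
    (hΩ : IsRegularDomain Ω) (hw : IsW11WithGradient Ω u G) (hq : 1 < q) (hM : 1 ≤ M)
    (hp : ∀ k, IsReducingPatch K' K'' q (M ^ q) δ s α (A k) (c k) (r k) (W k) (g k))
    (i : Fin d) (j : Fin m) : IntegrableOn (fun x => (G x + ∑' k, g k x) i j) Ω := by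
  have hg : ∀ k, ∀ x ∉ ball (c k) (r k), g k x = 0 := fun k => (hp k).grad_eq_zero
  have hmeas : AEStronglyMeasurable (fun x => (G x + ∑' k, g k x) i j) (volume.restrict Ω) :=
    (hw.integrableOn_grad i j).aestronglyMeasurable.add
      (aestronglyMeasurable_tsum_apply (fun _ => measurableSet_ball) h.disjoint h.iUnion_ball_ae_eq
        hg i j fun k => ((hp k).integrable_grad_apply i j).aestronglyMeasurable)
  have hbound : ∫⁻ x in Ω, ENNReal.ofReal (matNorm (G x + ∑' k, g k x)) ≤
      ∫⁻ x in Ω, ENNReal.ofReal ((1 + 1 / (q - 1)) * (M * (1 + matNorm (G x)))) := by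
    simpa only [mem_univ, and_true, ofPred_mem_eq] using
      h.setLIntegral_grad_add_tsum_le hw hg (T := univ)
        (F := fun B => ENNReal.ofReal (matNorm B))
        (Φ := fun B => ENNReal.ofReal ((1 + 1 / (q - 1)) * (M * (1 + matNorm B))))
        fun k => by
          simpa only [mem_univ, and_true, ofPred_mem_eq] using (hp k).setLIntegral_matNorm_le hq hM
  have hfin : IntegrableOn (fun x => (1 + 1 / (q - 1)) * (M * (1 + matNorm (G x)))) Ω :=
    (((integrableOn_const hΩ.isBounded.measure_lt_top.ne).add
      (integrable_matNorm hw.integrableOn_grad)).const_mul _).const_mul _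
  refine ⟨hmeas, (lintegral_mono fun x => ?_).trans_lt (hbound.trans_lt hfin.lintegral_lt_top)⟩
  rw [Real.enorm_eq_ofReal_abs]
  exact ENNReal.ofReal_le_ofReal (abs_entry_le_matNorm _ i j)

theorem isW11WithGradient_add_tsum (h : IsAffineBallPartition Ω u c r A)
    (hΩ : IsRegularDomain Ω) (hw : IsW11WithGradient Ω u G) (hα : 0 < α) (hq : 1 < q) (hM : 1 ≤ M)
    (hp : ∀ k, IsReducingPatch K' K'' q (M ^ q) δ s α (A k) (c k) (r k) (W k) (g k)) :
    IsW11WithGradient Ω (fun x => u x + ∑' k, W k x) fun x => G x + ∑' k, g k x := by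
  refine hw.add (isW11WithGradient_tsum (fun _ => measurableSet_ball) h.disjoint
    h.iUnion_ball_ae_eq (fun k => (hp k).w11) (fun k => (hp k).eq_zero)
    (fun k => (hp k).grad_eq_zero)
    (integrableOn_holderWith hα (h.holderWith_tsum hp) hΩ.isBounded) fun i j => ?_)
  refine ((h.integrableOn_grad_add_tsum_apply hΩ hw hq hM hp i j).sub
    (hw.integrableOn_grad i j)).congr (ae_of_all _ fun x => ?_)
  simp only [Pi.sub_apply, Matrix.add_apply, add_sub_cancel_left]

theorem setLIntegral_grad_add_tsum_notMem_lt (h : IsAffineBallPartition Ω u c r A)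
    (hΩ : IsRegularDomain Ω) (hw : IsW11WithGradient Ω u G) (hδ : 0 ≤ δ) (hε : 0 ≤ ε)
    (hs : s ≤ s')
    (hp : ∀ k, IsReducingPatch K' K'' q C δ s α (A k) (c k) (r k) (W k) (g k))
    (herr : ∫⁻ x in {x ∈ Ω | G x ∉ K'}, ENNReal.ofReal ((1 + matNorm (G x)) ^ s') <
      ENNReal.ofReal ε * volume Ω) :
    ∫⁻ x in {x ∈ Ω | G x + ∑' k, g k x ∉ K''},
        ENNReal.ofReal ((1 + matNorm (G x + ∑' k, g k x)) ^ s) <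
      ENNReal.ofReal (δ + ε) * volume Ω := by
  have hfin : ENNReal.ofReal δ * volume Ω ≠ ⊤ :=
    ENNReal.mul_ne_top ENNReal.ofReal_ne_top hΩ.isBounded.measure_lt_top.ne
  calc ∫⁻ x in {x ∈ Ω | G x + ∑' k, g k x ∉ K''},
        ENNReal.ofReal ((1 + matNorm (G x + ∑' k, g k x)) ^ s)
      ≤ ∫⁻ x in Ω, (ENNReal.ofReal δ + excess K' s (G x)) :=
        h.setLIntegral_grad_add_tsum_le hw (fun k => (hp k).grad_eq_zero) (T := K''ᶜ)
          (F := fun B => ENNReal.ofReal ((1 + matNorm B) ^ s))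
          (Φ := fun B => ENNReal.ofReal δ + excess K' s B) fun k => (hp k).setLIntegral_le
    _ = ENNReal.ofReal δ * volume Ω + ∫⁻ x in Ω, excess K' s (G x) := by
        rw [lintegral_add_left measurable_const, setLIntegral_const]
    _ < ENNReal.ofReal δ * volume Ω + ENNReal.ofReal ε * volume Ω :=
        ENNReal.add_lt_add_of_le_of_lt hfin le_rfl <|
          (lintegral_mono fun x => excess_mono hs (G x)).trans_lt <|
            (setLIntegral_excess_le hΩ.isOpen.measurableSet G).trans_lt herr
    _ = ENNReal.ofReal (δ + ε) * volume Ω := by rw [ENNReal.ofReal_add hδ hε, add_mul]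

theorem volume_lt_matNorm_grad_add_tsum_le_lintegral (h : IsAffineBallPartition Ω u c r A)
    (hw : IsW11WithGradient Ω u G) {e t : ℝ} (he : 0 ≤ e) (hes : e ≤ s') (ht : 0 < t)
    (hp : ∀ k, IsReducingPatch K' K'' q C δ s α (A k) (c k) (r k) (W k) (g k)) :
    volume {x ∈ Ω | t < matNorm (G x + ∑' k, g k x)} ≤
      ∫⁻ x in Ω, (ENNReal.ofReal (min 1 (C * (1 + matNorm (G x) ^ q) * t ^ (-q))) +
        ENNReal.ofReal (t ^ (-e)) * excess K' s' (G x)) := by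
  simpa only [setLIntegral_one, mem_ofPred_eq] using
    h.setLIntegral_grad_add_tsum_le hw (fun k => (hp k).grad_eq_zero) (T := {B | t < matNorm B})
      (F := fun _ => 1)
      (Φ := fun B => ENNReal.ofReal (min 1 (C * (1 + matNorm B ^ q) * t ^ (-q))) +
        ENNReal.ofReal (t ^ (-e)) * excess K' s' B)
      fun k => (setLIntegral_one _).trans_le ((hp k).volume_lt_le he hes ht)

theorem volume_lt_matNorm_grad_add_tsum_le (h : IsAffineBallPartition Ω u c r A)
    (hw : IsW11WithGradient Ω u G) (hp0 : 0 < p) (hq : 0 < q) (hpq : p ≠ q) (hM' : 1 ≤ M')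
    (hM : 1 ≤ M) (hN : 0 ≤ N) (hs : min p q ≤ s')
    (hp : ∀ k, IsReducingPatch K' K'' q (M ^ q) δ s α (A k) (c k) (r k) (W k) (g k))
    (hexcess : ∫⁻ x in Ω, excess K' s' (G x) ≤ volume Ω)
    (hweak : HasWeakLpBound p (M' ^ p * (1 + N ^ p)) (fun x => matNorm (G x)) (volume.restrict Ω))
    {t : ℝ} (ht : 0 < t) :
    volume {x ∈ Ω | t < matNorm (G x + ∑' k, g k x)} ≤
      ENNReal.ofReal (4 * (1 + q / |q - p|) * (M' * M) ^ min p q * (1 + N ^ min p q) *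
        t ^ (-min p q)) * volume Ω := by
  have he : 0 < min p q := lt_min hp0 hq
  have hθ : 0 ≤ q / |q - p| := by positivity
  have hM'M : 1 ≤ M' * M := one_le_mul_of_one_le_of_one_le hM' hM
  have hmeas : AEMeasurable (fun x => matNorm (G x)) (volume.restrict Ω) :=
    aemeasurable_matNorm fun i j => (hw.integrableOn_grad i j).aemeasurable
  have hmin := hweak.lintegral_min_one_mul_rpow_neg_le (fun x => matNorm_nonneg (G x)) hmeas hp0 hq
    hpq hM' (one_pos.trans_le hM) hN ht
  rw [Measure.restrict_apply_univ] at hmin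
  set D : ℝ := (M' * M) ^ min p q * (1 + N ^ min p q) * t ^ (-min p q) with hD
  have hD0 : 0 ≤ D := by positivity
  have htD : t ^ (-min p q) ≤ D :=
    le_mul_of_one_le_left (by positivity) (one_le_mul_of_one_le_of_one_le
      (Real.one_le_rpow hM'M he.le) (le_add_of_nonneg_right (Real.rpow_nonneg hN _)))
  calc volume {x ∈ Ω | t < matNorm (G x + ∑' k, g k x)}
      ≤ ∫⁻ x in Ω, (ENNReal.ofReal (min 1 (M ^ q * (1 + matNorm (G x) ^ q) * t ^ (-q))) +
          ENNReal.ofReal (t ^ (-min p q)) * excess K' s' (G x)) :=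
        h.volume_lt_matNorm_grad_add_tsum_le_lintegral hw he.le hs ht hp
    _ = (∫⁻ x in Ω, ENNReal.ofReal (min 1 (M ^ q * (1 + matNorm (G x) ^ q) * t ^ (-q)))) +
          ENNReal.ofReal (t ^ (-min p q)) * ∫⁻ x in Ω, excess K' s' (G x) := by
        rw [lintegral_add_left' (by fun_prop), lintegral_const_mul' _ _ ENNReal.ofReal_ne_top]
    _ ≤ ENNReal.ofReal ((2 + q / |q - p|) * D) * volume Ω + ENNReal.ofReal D * volume Ω := by
        gcongr
    _ = ENNReal.ofReal ((2 + q / |q - p|) * D + D) * volume Ω := by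
        rw [← add_mul, ← ENNReal.ofReal_add (by positivity) hD0]
    _ ≤ ENNReal.ofReal (4 * (1 + q / |q - p|) * D) * volume Ω := by
        gcongr ENNReal.ofReal ?_ * volume Ω
        nlinarith
    _ = _ := by simp only [hD, mul_assoc]

end IsAffineBallPartition

end Gluing

theorem ReductionBound.trans {K K' K'' : Set (Mat d m)} {p q M' M'' : ℝ} (hp : 0 < p) (hq : 1 < q)
    (hpq : p ≠ q) (hM' : 1 ≤ M') (hM'' : 1 ≤ M'') (h₁ : ReductionBound K K' p (M' ^ p))
    (h₂ : ReductionBound K' K'' q (M'' ^ q)) :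
    ReductionBound K K'' (min p q) (4 * (1 + q / |q - p|) * (M' * M'') ^ min p q) := by
  intro A hA b ε α s hε hε1 hα hα1 hs Ω hΩ
  have hε2 : ε / 2 < 1 := by linarith
  obtain ⟨u, G, hpa, hw, ⟨H, hH⟩, hbd, herr, hweak⟩ :=
    h₁ A hA b (ε / 2) α (max s (min p q)) (half_pos hε) hε2 hα hα1 (lt_max_of_lt_left hs) Ω hΩ
  choose R hR hpatch using fun B =>
    h₂.exists_isReducingPatch B (half_pos hε) hε2 hα hα1 hs
  obtain ⟨ι, _, c, r, B, hpart, hrR⟩ := hpa.exists_isAffineBallPartition hR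
  choose W g hWg using fun k => hpatch (B k) (c k) (r k) (hpart.radius_pos k) (hrR k)
  have hW : ∀ k, ∀ x ∉ Metric.ball (c k) (r k), W k x = 0 := fun k => (hWg k).eq_zero
  have hexcess : ∫⁻ x in Ω, excess K' (max s (min p q)) (G x) ≤ volume Ω :=
    (setLIntegral_excess_le hΩ.isOpen.measurableSet G).trans
      (herr.le.trans (mul_le_of_le_one_left' (ENNReal.ofReal_le_one.2 hε2.le)))
  refine ⟨fun x => u x + ∑' k, W k x, fun x => G x + ∑' k, g k x,
    hpart.isPiecewiseAffine_add_tsum hW fun k => (hWg k).piecewise,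
    hpart.isW11WithGradient_add_tsum hΩ hw hα hq hM'' hWg,
    ⟨_, holderOnWith_add hH ((hpart.holderWith_tsum hWg).holderOnWith _)⟩,
    fun x hx => ?_, ?_, fun t ht => ?_⟩
  · simp only [hpart.tsum_eq_zero_of_mem_frontier hΩ.isOpen hW hx, add_zero, hbd hx]
  · simpa only [add_halves] using hpart.setLIntegral_grad_add_tsum_notMem_lt hΩ hw
      (half_pos hε).le (half_pos hε).le (le_max_left _ _) hWg herr
  · exact hpart.volume_lt_matNorm_grad_add_tsum_le hw hp (one_pos.trans hq) hpq hM' hM''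
      (matNorm_nonneg A) (le_max_right _ _) hWg hexcess
      (HasReductionEstimates.hasWeakLpBound ⟨herr.le, hweak⟩ hΩ.isOpen.measurableSet) ht

theorem ReductionBound.canBeReduced {K K' : Set (Mat d m)} {p C : ℝ} (h : ReductionBound K K' p C)
    (hp : 0 < p) (hC : 1 ≤ C) : CanBeReduced K K' p := by
  refine ⟨C ^ p⁻¹, Real.one_le_rpow hC (inv_nonneg.2 hp.le), ?_⟩
  rwa [Real.rpow_inv_rpow (zero_le_one.trans hC) hp.ne']

end WeakReduction

theorem theorem4p3_general {d m : ℕ} (K K' K'' : Set (WeakReduction.Mat d m)) (p q : ℝ)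
    (hp : 0 < p) (hq : 1 < q) (hpq : p ≠ q)
    (h₁ : WeakReduction.CanBeReduced K K' p) (h₂ : WeakReduction.CanBeReduced K' K'' q) :
    WeakReduction.CanBeReduced K K'' (min p q) ∧
    ∀ M' M'' : ℝ, 1 ≤ M' → 1 ≤ M'' →
      WeakReduction.ReductionBound K K' p (M' ^ p) →
      WeakReduction.ReductionBound K' K'' q (M'' ^ q) →
      WeakReduction.ReductionBound K K'' (min p q)
        (4 * (1 + q / |q - p|) * (M' * M'') ^ (min p q)) := by
  refine ⟨?_, fun M' M'' hM' hM'' h h' => h.trans hp hq hpq hM' hM'' h'⟩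
  obtain ⟨M', hM', h⟩ := h₁
  obtain ⟨M'', hM'', h'⟩ := h₂
  have hr : 0 < min p q := lt_min hp (one_pos.trans hq)
  have hθ : 0 ≤ q / |q - p| := div_nonneg (one_pos.trans hq).le (abs_nonneg _)
  have hM'M'' : 1 ≤ M' * M'' := one_le_mul_of_one_le_of_one_le hM' hM''
  exact (h.trans hp hq hpq hM' hM'' h').canBeReduced hr
    (one_le_mul_of_one_le_of_one_le (by linarith) (Real.one_le_rpow hM'M'' hr.le))

theorem theorem4p3 {d m : ℕ} (K K' K'' : Set (WeakReduction.Mat d m)) (p q : ℝ)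
    (hp : 1 ≤ p) (hq : 1 < q) (hpq : p ≠ q)
    (h₁ : WeakReduction.CanBeReduced K K' p) (h₂ : WeakReduction.CanBeReduced K' K'' q) :
    WeakReduction.CanBeReduced K K'' (min p q) ∧
    ∀ M' M'' : ℝ, 1 ≤ M' → 1 ≤ M'' →
      WeakReduction.ReductionBound K K' p (M' ^ p) →
      WeakReduction.ReductionBound K' K'' q (M'' ^ q) →
      WeakReduction.ReductionBound K K'' (min p q)
        (4 * (1 + q / |q - p|) * (M' * M'') ^ (min p q)) :=
  theorem4p3_general K K' K'' p q (one_pos.trans_le hp) hq hpq h₁ h₂
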